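/- Let $K/F$ be a Galois extension of degree $2$ with group $G=\mathrm{Gal}(K/F)=\langle\sigma\rangle$, where $F$ contains a primitive second root of unity (i.e. $\operatorname{char}F\neq 2$), and suppose that $-1\notin N_{K/F}(K^\times)$. For $m\ge 1$ put $R_m=\mathbb Z/2^m\mathbb Z$ and let $J_m=K^\times/K^{\times 2^m}$, an $R_mG$-module; let $J_\infty=\varprojlim_m J_m$, a $\mathbb Z_2G$-module. Let $\nu\in\mathbb N\cup\{\infty\}$ be the supremum of all $k$ such that $K$ contains a primitive $2^k$-th root of unity, and put $$e_0=\dim_{\mathbb F_2}F^{\times}/N_{K/F}(K^\times)F^{\times 2},\qquad e_1=\dim_{\mathbb F_2}N_{K/F}(K^\times)F^{\times 2}/F^{\times 2}$$ (cardinal numbers, possibly infinite). For a $\mathbb Z_2G$-module $M$ write $\widehat M=\varprojlim_m M/2^mM$ for its $2$-adic completion. Then there are a trivial $\mathbb Z_2G$-module $Y_0$ which is free over $\mathbb Z_2$ of rank $e(0)$ with $e(0)+1=e_0$, and a free $\mathbb Z_2G$-module $Y_1$ of rank $e(1)$, where $e(1)+1=e_1$ if $\nu<\infty$ and $e(1)=e_1$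 if $\nu=\infty$, such that the following hold. If $\nu=\infty$, then $J_\infty\simeq\widehat{Y_0}\oplus\widehat{Y_1}$ as $\mathbb Z_2G$-modules, and $J_m\simeq Y_0/2^m\oplus Y_1/2^m$ as $R_mG$-modules for every $m\ge1$. If $\nu<\infty$, then $J_\infty\simeq Z\oplus\widehat{Y_0}\oplus\widehat{Y_1}$ as $\mathbb Z_2G$-modules, and $J_m\simeq Z/2^m\oplus Y_0/2^m\oplus Y_1/2^m$ as $R_mG$-modules for every $m\ge1$, where $Z=\mathbb Z_2G/\langle 2^\nu(\sigma-1)\rangle$ is an indecomposable $\mathbb Z_2G$-module and $Z/2^m$ is an indecomposable $R_mG$-module. In both cases $Y_0/2^m$ is a trivial $R_mG$-module which is free over $R_m$ of rank $e(0)$, and $Y_1/2^m$ is a free $R_mG$-module of rank $e(1)$. If $e(0)$ and $e(1)$ are finite, no completion is needed: $J_\infty\simeq Y_0\oplus Y_1$ if $\nu=\infty$, and $J_\infty\simeq Z\oplus Y_0\oplus Y_1$ if $\nu<\infty$. -/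

import Mathlib

open scoped Cardinal

universe u v

/-! ### Reduction modulo `p ^ m` and `p`-adic completion of a representation -/

section Reduction

variable {A G V : Type*} [CommRing A] [Group G] [AddCommGroup V] [Module A V]

/-- The subgroup `p ^ m V` of an abelian group `V`. -/
def powSubgroup (p m : ℕ) (V : Type*) [AddCommGroup V] : AddSubgroup V :=
  (nsmulAddMonoidHom (p ^ m) : V →+ V).range

/-- The quotient `V / p ^ m V`. -/
abbrev ModPow (p m : ℕ) (V : Type*) [AddCommGroup V] : Type _ := V ⧸ powSubgroup p m V

/-- `V / p ^ m V` is a module over `ℤ / p ^ m`. -/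
instance ModPow.instModule (p m : ℕ) (V : Type*) [AddCommGroup V] :
    Module (ZMod (p ^ m)) (ModPow p m V) :=
  QuotientAddGroup.zmodModule (fun x => ⟨x, rfl⟩)

theorem map_mem_powSubgroup (p m : ℕ) {W : Type*} [AddCommGroup W] (f : V →+ W) :
    powSubgroup p m V ≤ (powSubgroup p m W).comap f := by
  rintro _ ⟨x, rfl⟩
  exact ⟨f x, by simp⟩

theorem powSubgroup_le (p : ℕ) {m n : ℕ} (h : m ≤ n) (V : Type*) [AddCommGroup V] :
    powSubgroup p n V ≤ powSubgroup p m V := by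
  rintro _ ⟨x, rfl⟩
  refine ⟨p ^ (n - m) • x, ?_⟩
  simp only [nsmulAddMonoidHom_apply]
  rw [smul_smul, ← pow_add, Nat.add_sub_cancel' h]

/-- The homomorphism `V / p ^ m V → W / p ^ m W` induced by `f : V → W`. -/
def ModPow.map (p m : ℕ) {V W : Type*} [AddCommGroup V] [AddCommGroup W] (f : V →+ W) :
    ModPow p m V →+ ModPow p m W :=
  QuotientAddGroup.map _ _ f (map_mem_powSubgroup p m f)

/-- The canonical projection `V / p ^ n V → V / p ^ m V` for `m ≤ n`. -/
def ModPow.proj (p : ℕ) {m n : ℕ} (h : m ≤ n) (V : Type*) [AddCommGroup V] :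
    ModPow p n V →+ ModPow p m V :=
  QuotientAddGroup.map _ _ (AddMonoidHom.id V) (powSubgroup_le p h V)

/-- The `(ℤ / p ^ m) G`-module `V / p ^ m V` attached to a representation `V` of `G`. -/
def Representation.modPow (ρ : Representation A G V) (p m : ℕ) :
    Representation (ZMod (p ^ m)) G (ModPow p m V) where
  toFun g := (ModPow.map p m (ρ g).toAddMonoidHom).toZModLinearMap (p ^ m)
  map_one' := by
    ext x
    induction x using QuotientAddGroup.induction_on with
    | H x => simp [ModPow.map]
  map_mul' g h := by
    ext x
    induction x using QuotientAddGroup.induction_on with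
    | H x => simp [ModPow.map]

/-- The underlying group of the inverse limit of the groups `V / p ^ m V`:
the compatible sequences. -/
def adicLimit (p : ℕ) (V : Type*) [AddCommGroup V] : AddSubgroup (∀ m : ℕ, ModPow p m V) where
  carrier := {x | ∀ (m n : ℕ) (h : m ≤ n), ModPow.proj p h V (x n) = x m}
  zero_mem' := by
    intro m n h
    simp
  add_mem' := by
    intro x y hx hy m n h
    simp [hx m n h, hy m n h]
  neg_mem' := by
    intro x hx m n h
    simp [hx m n h]

theorem ModPow.proj_smul (p : ℕ) [Fact p.Prime] {m n : ℕ} (h : m ≤ n) (a : ℤ_[p])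
    (x : ModPow p n V) :
    ModPow.proj p h V (PadicInt.toZModPow n a • x) =
      PadicInt.toZModPow m a • ModPow.proj p h V x := by
  obtain ⟨k, hk⟩ := ZMod.intCast_surjective (PadicInt.toZModPow n a)
  have hk' : PadicInt.toZModPow m a = (k : ZMod (p ^ m)) := by
    rw [← PadicInt.cast_toZModPow m n h, ← hk]
    exact ZMod.cast_intCast (pow_dvd_pow p h) k
  rw [hk', ← hk, Int.cast_smul_eq_zsmul, Int.cast_smul_eq_zsmul, map_zsmul]

/-- The inverse limit of the groups `V / p ^ m V` is a `ℤ_p`-module: `ℤ_p` acts on `V / p ^ m V`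
through `ℤ / p ^ m`. -/
noncomputable instance adicLimit.instModule (p : ℕ) [Fact p.Prime] :
    Module ℤ_[p] (adicLimit p V) where
  smul a x := ⟨fun m => PadicInt.toZModPow m a • x.1 m, fun m n h => by
    rw [ModPow.proj_smul, x.2 m n h]⟩
  one_smul x := Subtype.ext (funext fun m => by
    change PadicInt.toZModPow m 1 • x.1 m = x.1 m
    simp)
  mul_smul a b x := Subtype.ext (funext fun m => by
    change PadicInt.toZModPow m (a * b) • x.1 m =
      PadicInt.toZModPow m a • PadicInt.toZModPow m b • x.1 m
    rw [map_mul, mul_smul])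
  smul_zero a := Subtype.ext (funext fun m => by
    change PadicInt.toZModPow m a • (0 : ModPow p m V) = 0
    simp)
  smul_add a x y := Subtype.ext (funext fun m => by
    change PadicInt.toZModPow m a • (x.1 m + y.1 m) =
      PadicInt.toZModPow m a • x.1 m + PadicInt.toZModPow m a • y.1 m
    rw [smul_add])
  add_smul a b x := Subtype.ext (funext fun m => by
    change PadicInt.toZModPow m (a + b) • x.1 m =
      PadicInt.toZModPow m a • x.1 m + PadicInt.toZModPow m b • x.1 m
    rw [map_add, add_smul])
  zero_smul x := Subtype.ext (funext fun m => by
    change PadicInt.toZModPow m 0 • x.1 m = 0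
    simp)

/-- The `ℤ_p G`-module `lim V / p ^ m V`, the `p`-adic completion of a representation `V` of `G`;
`G` acts termwise. -/
noncomputable def Representation.adicCompletion (ρ : Representation A G V) (p : ℕ)
    [Fact p.Prime] : Representation ℤ_[p] G (adicLimit p V) where
  toFun g :=
    { toFun := fun x => ⟨fun m => ρ.modPow p m g (x.1 m), fun m n h => by
        change ModPow.proj p h V (ρ.modPow p n g (x.1 n)) = ρ.modPow p m g (x.1 m)
        rw [← x.2 m n h]
        obtain ⟨y, hy⟩ := QuotientAddGroup.mk_surjective (x.1 n)
        rw [← hy]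
        rfl⟩
      map_add' := fun x y => Subtype.ext (funext fun m => map_add _ _ _)
      map_smul' := fun a x => Subtype.ext (funext fun m => map_smul _ _ _) }
  map_one' := by
    ext x : 1
    refine Subtype.ext (funext fun m => ?_)
    change ρ.modPow p m 1 (x.1 m) = x.1 m
    rw [map_one]
    rfl
  map_mul' g h := by
    ext x : 1
    refine Subtype.ext (funext fun m => ?_)
    change ρ.modPow p m (g * h) (x.1 m) = ρ.modPow p m g (ρ.modPow p m h (x.1 m))
    rw [map_mul]
    rfl

end Reduction

/-- An indecomposable module: nonzero, and not the direct sum of two nonzero submodules. -/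
def IsIndecomposableModule (R M : Type*) [Ring R] [AddCommGroup M] [Module R M] : Prop :=
  Nontrivial M ∧ ∀ N N' : Submodule R M, IsCompl N N' → N = ⊥ ∨ N' = ⊥

/-! ### The modules of power classes -/

section PowerClasses

variable (F K : Type*) [Field F] [Field K] [Algebra F K]

/-- The group `Kˣ`, written additively, with its action of `Gal(K/F)`. -/
abbrev unitsRep : Representation ℤ Gal(K/F) (Additive Kˣ) :=
  Representation.ofMulDistribMulAction Gal(K/F) Kˣ

/-- The module `J_m = Kˣ / (Kˣ) ^ (p ^ m)` over `(ℤ / p ^ m) Gal(K/F)`. -/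
abbrev PowerClasses (p m : ℕ) : Type _ := ((unitsRep F K).modPow p m).asModule

/-- The module `J_∞`, the inverse limit of the `J_m`, over `ℤ_p Gal(K/F)`. -/
abbrev PowerClassesLimit (p : ℕ) [Fact p.Prime] : Type _ :=
  ((unitsRep F K).adicCompletion p).asModule

/-- The largest `ν ∈ ℕ ∪ {∞}` such that `K` contains a primitive `p ^ k`-th root of unity for all
natural numbers `k ≤ ν`. -/
noncomputable def rootLevel (p : ℕ) (K : Type*) [Field K] : ℕ∞ :=
  sSup {a : ℕ∞ | ∃ k : ℕ, a = k ∧ ∃ ζ : K, IsPrimitiveRoot ζ (p ^ k)}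

/-- The subgroup `(Fˣ) ^ p`. -/
def unitPowers (p : ℕ) (F : Type*) [Field F] : Subgroup Fˣ :=
  (powMonoidHom p : Fˣ →* Fˣ).range

/-- The subgroup `N_{K/F}(Kˣ) (Fˣ) ^ p` of `Fˣ`. -/
noncomputable def normPowers (p : ℕ) : Subgroup Fˣ :=
  (Units.map (Algebra.norm F : K →* F)).range ⊔ unitPowers p F

/-- The group `A / B`, written additively, for subgroups `B ≤ A` of `Fˣ`. -/
def UnitQuotient {F : Type*} [Field F] (A B : Subgroup Fˣ) : Type _ :=
  Additive (A ⧸ B.subgroupOf A)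

instance {F : Type*} [Field F] (A B : Subgroup Fˣ) : AddCommGroup (UnitQuotient A B) :=
  inferInstanceAs (AddCommGroup (Additive (A ⧸ B.subgroupOf A)))

theorem UnitQuotient.nsmul_eq_zero {F : Type*} [Field F] (p : ℕ) (A B : Subgroup Fˣ)
    (hB : unitPowers p F ≤ B) (x : UnitQuotient A B) : p • x = 0 := by
  obtain ⟨a, ha⟩ := QuotientGroup.mk_surjective (s := B.subgroupOf A) (Additive.toMul x)
  have h : (a : A ⧸ B.subgroupOf A) ^ p = 1 := by
    rw [← QuotientGroup.mk_pow, QuotientGroup.eq_one_iff, Subgroup.mem_subgroupOf]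
    exact hB ⟨a.1, rfl⟩
  rw [ha] at h
  exact h

/-- The dimension over `𝔽_p` of `A / B`, for subgroups `B ≤ A` of `Fˣ` such that `B` contains
the `p`-th powers. -/
noncomputable def dimQuot {F : Type*} [Field F] (p : ℕ) [Fact p.Prime] (A B : Subgroup Fˣ)
    (hB : unitPowers p F ≤ B) : Cardinal :=
  letI : Module (ZMod p) (UnitQuotient A B) :=
    AddCommGroup.zmodModule (UnitQuotient.nsmul_eq_zero p A B hB)
  Module.rank (ZMod p) (UnitQuotient A B)

/-- `e_0(K/F)` for an extension `K/F` of degree `p`: the dimension over `𝔽_p` of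
`N_{F/F}(Fˣ) (Fˣ) ^ p / N_{K/F}(Kˣ) (Fˣ) ^ p`. -/
noncomputable def rankZero (p : ℕ) [Fact p.Prime] : Cardinal :=
  dimQuot p (normPowers F F p) (normPowers F K p) le_sup_right

/-- `e_1(K/F)` for an extension `K/F` of degree `p`: the dimension over `𝔽_p` of
`N_{K/F}(Kˣ) (Fˣ) ^ p / (Fˣ) ^ p`. -/
noncomputable def rankOne (p : ℕ) [Fact p.Prime] : Cardinal :=
  dimQuot p (normPowers F K p) (unitPowers p F) le_rfl

end PowerClasses

/-! ### The summands -/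

section Summands

/-- The trivial `A G`-module which is free over `A` with a basis indexed by `ι`. -/
noncomputable abbrev trivialRep (A G ι : Type*) [CommRing A] [Group G] : Representation A G (ι →₀ A) :=
  Representation.trivial A G (ι →₀ A)

/-- The free `A G`-module with a basis indexed by `ι`, as a representation. -/
noncomputable abbrev freeRep (A G ι : Type*) [CommRing A] [Group G] :
    Representation A G (ι →₀ MonoidAlgebra A G) :=
  Representation.ofModule' (ι →₀ MonoidAlgebra A G)

/-- The cyclic `A G`-module `A G / ⟨p ^ ν (σ - 1)⟩`. -/
abbrev CyclicModule (A : Type*) {G : Type*} [CommRing A] [Group G] (p ν : ℕ) (σ : G) : Type _ :=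
  MonoidAlgebra A G ⧸
    Ideal.span {(p : MonoidAlgebra A G) ^ ν * (MonoidAlgebra.of A G σ - 1)}

/-- The cyclic module `A G / ⟨p ^ ν (σ - 1)⟩`, as a representation. -/
noncomputable abbrev cyclicRep (A : Type*) {G : Type*} [CommRing A] [Group G] (p ν : ℕ) (σ : G) :
    Representation A G (CyclicModule A p ν σ) :=
  Representation.ofModule' (CyclicModule A p ν σ)

end Summands

/-! Everything is read off from one integral model: an explicit ℤG-module `V` with an equivariant
homomorphism φ from `V` to Kˣ that is an isomorphism modulo 2^m for every m. Here `V` is a sum of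
copies of ℤ, copies of ℤG and, if ν is finite, one module ℤG/⟨2^ν(σ-1)⟩. Such a φ determines all J_m
and J_∞ at once. The map from `V` to the same module built over ℤ_2 is also an isomorphism modulo
every 2^m, so the ℤ_2-modules of the theorem have the same reductions and completions as Kˣ.

Modulo 2 the model comes from norms (`isModPowIso_two_one_of_norm`). Choose d with σd = -d and put a
= d². Since -1 is not a norm, neither is a; but a becomes a square in K, and it generates the kernel
of Fˣ/2 → Kˣ/2. Complete a to a basis of Fˣ modulo norms by elements f_i, and take x_j in Kˣ whose
norms form a basis of the norms modulo squares. By Hilbert 90 the classes of f_i, x_j and σx_j form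
a basis of Kˣ/2. The f_i span the trivial part and the pairs x_j, σx_j the free part; the lost class
of a accounts for e(0) + 1 = e_0.

To pass from 2 to 2^m (`IsModPowIso.of_one`), only the 2-torsion {1, -1} of Kˣ can obstruct. If ν =
∞, then -1 is a 2^m-th power for all m and there is no obstruction. If ν is finite, the model itself
must have a torsion element mapping to -1. A root of unity ξ of order 2^ν has norm 1, because -1 is
not a norm, so ξ = σα/α. The norm of α is not a square, since otherwise ξ would be a square in K,
against the maximality of ν. Hence α can be one of the x_j, and as 2^ν(σ-1) kills it, its free
summand may be replaced by the cyclic module, in which 2^(ν-1)(σ-1) maps to -1. This uses up one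
free generator, whence e(1) + 1 = e_1.

The cyclic module and its reductions are indecomposable because they are cyclic over local group
rings. -/

/-! ### Homomorphisms inducing isomorphisms modulo `p ^ m` -/

section ModPowIso

variable {V W X : Type*} [AddCommGroup V] [AddCommGroup W] [AddCommGroup X]

/-- `f : V → W` induces an isomorphism `V / p ^ m V → W / p ^ m W`. -/
structure IsModPowIso (p m : ℕ) (f : V →+ W) : Prop where
  inj : ∀ v w, f v = p ^ m • w → ∃ v', v = p ^ m • v'
  surj : ∀ w, ∃ v w', w = f v + p ^ m • w'

theorem ModPow.mk_eq_zero {p m : ℕ} {x : V} :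
    (QuotientAddGroup.mk x : ModPow p m V) = 0 ↔ ∃ y, x = p ^ m • y := by
  rw [QuotientAddGroup.eq_zero_iff]
  exact ⟨fun ⟨y, hy⟩ => ⟨y, hy.symm⟩, fun ⟨y, hy⟩ => ⟨y, hy.symm⟩⟩

theorem ModPow.map_mk {p m : ℕ} (f : V →+ W) (x : V) :
    ModPow.map p m f (QuotientAddGroup.mk x) = QuotientAddGroup.mk (f x) := rfl

theorem IsModPowIso.bijective {p m : ℕ} {f : V →+ W} (h : IsModPowIso p m f) :
    Function.Bijective (ModPow.map p m f) := by
  constructor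
  · rw [injective_iff_map_eq_zero]
    intro x hx
    obtain ⟨v, rfl⟩ := QuotientAddGroup.mk_surjective x
    rw [ModPow.map_mk, ModPow.mk_eq_zero] at hx
    obtain ⟨w, hw⟩ := hx
    exact ModPow.mk_eq_zero.2 (h.inj v w hw)
  · intro y
    obtain ⟨w, rfl⟩ := QuotientAddGroup.mk_surjective y
    obtain ⟨v, w', hw⟩ := h.surj w
    refine ⟨QuotientAddGroup.mk v, ?_⟩
    rw [ModPow.map_mk, ← sub_eq_zero, ← QuotientAddGroup.mk_sub, ModPow.mk_eq_zero]
    exact ⟨-w', by rw [hw]; simp⟩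

theorem isModPowIso_zero (p : ℕ) (f : V →+ W) : IsModPowIso p 0 f :=
  ⟨fun v _ _ => ⟨v, by simp⟩, fun w => ⟨0, w, by simp⟩⟩

/-- Divisibility by p^m is preserved by `g`, so both conditions descend along it. This allows
relations already killed in the target to be imposed on the source. -/
theorem IsModPowIso.of_comp_surjective {p m : ℕ} {g : V →+ W} {f : W →+ X}
    (h : IsModPowIso p m (f.comp g)) (hg : Function.Surjective g) : IsModPowIso p m f := by
  constructor
  · intro w x hx
    obtain ⟨v, rfl⟩ := hg w
    obtain ⟨v', rfl⟩ := h.inj v x hx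
    exact ⟨g v', by simp⟩
  · intro x
    obtain ⟨v, x', hx⟩ := h.surj x
    exact ⟨g v, x', hx⟩

/-- An isomorphism modulo `p` is an isomorphism modulo all powers of `p` if it hits
the `p`-torsion of the target up to `p`-divisible elements. -/
theorem IsModPowIso.of_one {p : ℕ} {f : V →+ W} (h : IsModPowIso p 1 f)
    (ht : ∀ (m : ℕ) (w : W), p • w = 0 → ∃ t w', p • t = 0 ∧ w = f t + p ^ m • w') (m : ℕ) :
    IsModPowIso p m f := by
  induction m with
  | zero => exact isModPowIso_zero p f
  | succ m ih =>
    constructor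
    · intro v w hv
      obtain ⟨v', rfl⟩ := h.inj v (p ^ m • w) (by rw [hv, smul_smul, ← pow_add, add_comm])
      rw [pow_one] at hv ⊢
      -- Dividing the equation by p leaves a p-torsion error. Subtracting `t` from `v'` absorbs it
      -- up to p^m, and `t` disappears again on multiplying by p.
      obtain ⟨t, w', ht0, htw⟩ := ht m (f v' - p ^ m • w) (by
        rw [smul_sub, ← map_nsmul, hv, smul_smul, ← pow_succ', sub_self])
      obtain ⟨v'', hv''⟩ := ih.inj (v' - t) (w + w') (by
        rw [map_sub, smul_add, sub_eq_iff_eq_add, add_assoc, add_comm _ (f t), ← htw]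
        abel)
      exact ⟨v'', by rw [pow_succ', mul_smul, ← hv'', smul_sub, ht0, sub_zero]⟩
    · intro w
      obtain ⟨v, w', hw⟩ := h.surj w
      obtain ⟨v', w'', hw'⟩ := ih.surj w'
      exact ⟨v + p • v', w'', by
        rw [hw, hw', pow_one, pow_succ', mul_smul]; simp [add_assoc]⟩

theorem IsModPowIso.prodMap {V' W' : Type*} [AddCommGroup V'] [AddCommGroup W'] {p m : ℕ}
    {f : V →+ W} {f' : V' →+ W'} (h : IsModPowIso p m f) (h' : IsModPowIso p m f') :
    IsModPowIso p m (f.prodMap f') := by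
  constructor
  · rintro ⟨v, v'⟩ ⟨w, w'⟩ hv
    obtain ⟨x, hx⟩ := h.inj v w (congrArg Prod.fst hv)
    obtain ⟨x', hx'⟩ := h'.inj v' w' (congrArg Prod.snd hv)
    exact ⟨(x, x'), Prod.ext hx hx'⟩
  · rintro ⟨w, w'⟩
    obtain ⟨x, y, hx⟩ := h.surj w
    obtain ⟨x', y', hx'⟩ := h'.surj w'
    exact ⟨(x, x'), (y, y'), Prod.ext hx hx'⟩

theorem IsModPowIso.mapRange {p m : ℕ} {f : V →+ W} (h : IsModPowIso p m f) (ι : Type*) :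
    IsModPowIso p m (Finsupp.mapRange.addMonoidHom f : (ι →₀ V) →+ (ι →₀ W)) := by
  classical
  constructor
  · intro v w hv
    choose g hg using fun i => h.inj (v i) (w i) (by simpa using DFunLike.congr_fun hv i)
    -- The chosen `g i` may be a nonzero torsion element where `v i = 0`; truncating keeps the
    -- support finite.
    refine ⟨Finsupp.onFinset v.support (fun i => if v i = 0 then 0 else g i) (by
      intro i hi
      rw [Finsupp.mem_support_iff]
      intro h0
      simp [h0] at hi), ?_⟩
    ext i
    by_cases h0 : v i = 0
    · simp [h0]
    · simpa [h0] using hg i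
  · intro w
    choose g g' hg using fun i => h.surj (w i)
    refine ⟨Finsupp.onFinset w.support (fun i => if w i = 0 then 0 else g i) (by
      intro i hi
      rw [Finsupp.mem_support_iff]
      intro h0
      simp [h0] at hi), Finsupp.onFinset w.support (fun i => if w i = 0 then 0 else g' i) (by
      intro i hi
      rw [Finsupp.mem_support_iff]
      intro h0
      simp [h0] at hi), ?_⟩
    ext i
    by_cases h0 : w i = 0
    · simp [h0]
    · simpa [h0] using hg i

/-- Injectivity needs every relation in `W₁` to come from a relation in `V₁` up to p^m, so that it
can be subtracted before dividing. Surjectivity is inherited. -/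
theorem IsModPowIso.quotientMap {p m : ℕ} {f : V →+ W} (h : IsModPowIso p m f)
    {V₁ : AddSubgroup V} {W₁ : AddSubgroup W} (hf : V₁ ≤ W₁.comap f)
    (hd : ∀ w ∈ W₁, ∃ v ∈ V₁, ∃ w', w = f v + p ^ m • w') :
    IsModPowIso p m (QuotientAddGroup.map V₁ W₁ f hf) := by
  constructor
  · intro v w hv
    obtain ⟨v, rfl⟩ := QuotientAddGroup.mk_surjective v
    obtain ⟨w, rfl⟩ := QuotientAddGroup.mk_surjective w
    rw [QuotientAddGroup.map_mk, ← QuotientAddGroup.mk_nsmul, ← sub_eq_zero,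
      ← QuotientAddGroup.mk_sub, QuotientAddGroup.eq_zero_iff] at hv
    obtain ⟨v₁, hv₁, w', hw'⟩ := hd _ hv
    obtain ⟨v', hv'⟩ := h.inj (v - v₁) (w + w') (by
      rw [map_sub, smul_add, sub_eq_iff_eq_add, add_assoc, add_comm _ (f v₁), ← hw']
      abel)
    refine ⟨QuotientAddGroup.mk v', ?_⟩
    rw [← QuotientAddGroup.mk_nsmul, ← hv', ← sub_eq_zero, ← QuotientAddGroup.mk_sub,
      QuotientAddGroup.eq_zero_iff]
    simpa using hv₁
  · intro w
    obtain ⟨w, rfl⟩ := QuotientAddGroup.mk_surjective w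
    obtain ⟨v, w', rfl⟩ := h.surj w
    exact ⟨QuotientAddGroup.mk v, QuotientAddGroup.mk w', rfl⟩

end ModPowIso

/-! ### Linear maps over a monoid algebra -/

section MonoidAlgebraLinear

variable {A G : Type*} [CommRing A] [Group G]

/-- An additive map which is compatible with the monomials of `A G` is `A G`-linear. -/
def linearMapOfSingle {X Y : Type*} [AddCommGroup X] [AddCommGroup Y]
    [Module (MonoidAlgebra A G) X] [Module (MonoidAlgebra A G) Y] (f : X →+ Y)
    (hf : ∀ g a x, f (MonoidAlgebra.single g a • x) = (MonoidAlgebra.single g a : MonoidAlgebra A G) • f x) :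
    X →ₗ[MonoidAlgebra A G] Y where
  toFun := f
  map_add' := f.map_add
  map_smul' r x := by
    induction r using MonoidAlgebra.induction_linear with
    | zero => simp
    | add r s hr hs => simp only [add_smul, map_add, RingHom.id_apply] at *; rw [hr, hs]
    | single g a => exact hf g a x

variable {V W : Type*} [AddCommGroup V] [AddCommGroup W] [Module A V] [Module A W]

/-- An equivariant linear map, as an `A G`-linear map. -/
noncomputable def Representation.asModuleMap (ρ : Representation A G V) (ρ' : Representation A G W)
    (f : V →ₗ[A] W) (hf : ∀ g x, f (ρ g x) = ρ' g (f x)) :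
    ρ.asModule →ₗ[MonoidAlgebra A G] ρ'.asModule :=
  linearMapOfSingle (X := ρ.asModule) (Y := ρ'.asModule) f.toAddMonoidHom (by
    intro g a x
    rw [Representation.single_smul, Representation.single_smul]
    exact (f.map_smul a (ρ g x)).trans (congrArg (a • ·) (hf g x)))

/-- The module attached to `Representation.ofModule' M` is `M`. -/
noncomputable def asModuleOfModule (M : Type*) [AddCommGroup M] [Module A M]
    [Module (MonoidAlgebra A G) M] [IsScalarTower A (MonoidAlgebra A G) M] :
    (Representation.ofModule' (k := A) (G := G) M).asModule ≃ₗ[MonoidAlgebra A G] M :=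
  LinearEquiv.ofBijective
    (linearMapOfSingle (X := (Representation.ofModule' (k := A) (G := G) M).asModule) (Y := M)
      (AddMonoidHom.id M) (by
      intro g a x
      rw [Representation.single_smul]
      have h (y : M) : Representation.ofModule' (k := A) (G := G) M g y =
        (MonoidAlgebra.single g 1 : MonoidAlgebra A G) • y := rfl
      have h' (y : M) : a • (MonoidAlgebra.single g 1 : MonoidAlgebra A G) • y =
          (MonoidAlgebra.single g a : MonoidAlgebra A G) • y := by
        rw [← smul_assoc, MonoidAlgebra.smul_single, smul_eq_mul, mul_one]
      exact (congrArg (a • ·) (h x)).trans (h' x))) Function.bijective_id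

end MonoidAlgebraLinear

/-! ### Functoriality of reduction -/

section ReductionFunctor

variable {A B C G V W X : Type*} [CommRing A] [CommRing B] [CommRing C] [Group G]
  [AddCommGroup V] [AddCommGroup W] [AddCommGroup X] [Module A V] [Module B W] [Module C X]

/-- The map `V / p ^ m V → W / p ^ m W` induced by an equivariant homomorphism. -/
noncomputable def Representation.modPowMap (p m : ℕ) (ρ : Representation A G V)
    (ρ' : Representation B G W) (f : V →+ W) (hf : ∀ g x, f (ρ g x) = ρ' g (f x)) :
    (ρ.modPow p m).asModule →ₗ[MonoidAlgebra (ZMod (p ^ m)) G] (ρ'.modPow p m).asModule :=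
  Representation.asModuleMap _ _ ((ModPow.map p m f).toZModLinearMap (p ^ m)) (by
    intro g x
    obtain ⟨x, rfl⟩ := QuotientAddGroup.mk_surjective x
    exact congrArg QuotientAddGroup.mk (hf g x))

/-- The isomorphism `V / p ^ m V ≃ W / p ^ m W` induced by an equivariant homomorphism. -/
noncomputable def IsModPowIso.equiv {p m : ℕ} {ρ : Representation A G V}
    {ρ' : Representation B G W} {f : V →+ W} (h : IsModPowIso p m f)
    (hf : ∀ g x, f (ρ g x) = ρ' g (f x)) :
    (ρ.modPow p m).asModule ≃ₗ[MonoidAlgebra (ZMod (p ^ m)) G] (ρ'.modPow p m).asModule :=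
  LinearEquiv.ofBijective (Representation.modPowMap p m ρ ρ' f hf) h.bijective

/-- Reduction commutes with binary products. -/
noncomputable def Representation.modPowProd {V' : Type*} [AddCommGroup V'] [Module A V'] (p m : ℕ)
    (ρ : Representation A G V) (ρ' : Representation A G V') :
    ((ρ.prod ρ').modPow p m).asModule ≃ₗ[MonoidAlgebra (ZMod (p ^ m)) G]
      (ρ.modPow p m).asModule × (ρ'.modPow p m).asModule :=
  LinearEquiv.ofBijective
    ((Representation.modPowMap p m (ρ.prod ρ') ρ (AddMonoidHom.fst V V') (fun _ _ => rfl)).prod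
      (Representation.modPowMap p m (ρ.prod ρ') ρ' (AddMonoidHom.snd V V') (fun _ _ => rfl))) (by
    constructor
    · rw [injective_iff_map_eq_zero]
      intro x hx
      obtain ⟨⟨v, v'⟩, rfl⟩ := QuotientAddGroup.mk_surjective x
      obtain ⟨w, hw⟩ := ModPow.mk_eq_zero.1 (congrArg Prod.fst hx)
      obtain ⟨w', hw'⟩ := ModPow.mk_eq_zero.1 (congrArg Prod.snd hx)
      exact ModPow.mk_eq_zero.2 ⟨(w, w'), Prod.ext hw hw'⟩
    · rintro ⟨y, y'⟩
      obtain ⟨v, rfl⟩ := QuotientAddGroup.mk_surjective y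
      obtain ⟨v', rfl⟩ := QuotientAddGroup.mk_surjective y'
      exact ⟨QuotientAddGroup.mk (v, v'), rfl⟩)

/-- A `ℤ / p ^ m`-linear representation is its own reduction modulo `p ^ m`. -/
noncomputable def Representation.modPowSelf (p m : ℕ) {V : Type*} [AddCommGroup V]
    [Module (ZMod (p ^ m)) V] (ρ : Representation (ZMod (p ^ m)) G V) :
    ρ.asModule ≃ₗ[MonoidAlgebra (ZMod (p ^ m)) G] (ρ.modPow p m).asModule :=
  LinearEquiv.ofBijective
    (Representation.asModuleMap ρ (ρ.modPow p m)
      ((QuotientAddGroup.mk' (powSubgroup p m V)).toZModLinearMap (p ^ m)) (fun _ _ => rfl)) (by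
    constructor
    · rw [injective_iff_map_eq_zero]
      intro x hx
      obtain ⟨y, hy⟩ := ModPow.mk_eq_zero.1 hx
      have h : (p ^ m) • y = 0 := by
        rw [← Nat.cast_smul_eq_nsmul (ZMod (p ^ m)), ZMod.natCast_self, zero_smul]
      exact hy.trans h
    · exact QuotientAddGroup.mk_surjective)

end ReductionFunctor

/-! ### Functoriality of the adic completion -/

section AdicFunctor

variable {A B G V W : Type*} [CommRing A] [CommRing B] [Group G]
  [AddCommGroup V] [AddCommGroup W] [Module A V] [Module B W] (p : ℕ) [Fact p.Prime]

/-- The homomorphism of inverse limits induced by a homomorphism. -/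
noncomputable def adicLimit.map {V W : Type*} [AddCommGroup V] [AddCommGroup W] (f : V →+ W) :
    adicLimit p V →ₗ[ℤ_[p]] adicLimit p W where
  toFun x := ⟨fun m => ModPow.map p m f (x.1 m), fun m n h => by
    change ModPow.proj p h W (ModPow.map p n f (x.1 n)) = ModPow.map p m f (x.1 m)
    rw [← x.2 m n h]
    obtain ⟨y, hy⟩ := QuotientAddGroup.mk_surjective (x.1 n)
    rw [← hy]
    rfl⟩
  map_add' x y := Subtype.ext (funext fun m => map_add _ _ _)
  map_smul' a x := Subtype.ext (funext fun m =>
    map_smul ((ModPow.map p m f).toZModLinearMap (p ^ m)) _ _)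

theorem adicLimit.map_bijective {V W : Type*} [AddCommGroup V] [AddCommGroup W] {f : V →+ W}
    (h : ∀ m, IsModPowIso p m f) : Function.Bijective (adicLimit.map p f) := by
  constructor
  · intro x y hxy
    refine Subtype.ext (funext fun m => (h m).bijective.1 ?_)
    exact congrFun (congrArg Subtype.val hxy) m
  · intro y
    choose x hx using fun m => (h m).bijective.2 (y.1 m)
    -- Preimages chosen level by level are automatically compatible, by injectivity at the lower
    -- level.
    refine ⟨⟨x, fun m n hmn => (h m).bijective.1 ?_⟩, Subtype.ext (funext hx)⟩
    rw [hx, ← y.2 m n hmn, ← hx n]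
    obtain ⟨v, hv⟩ := QuotientAddGroup.mk_surjective (x n)
    rw [← hv]
    rfl

/-- The map of adic completions induced by an equivariant homomorphism. -/
noncomputable def Representation.adicMap (ρ : Representation A G V)
    (ρ' : Representation B G W) (f : V →+ W) (hf : ∀ g x, f (ρ g x) = ρ' g (f x)) :
    (ρ.adicCompletion p).asModule →ₗ[MonoidAlgebra ℤ_[p] G] (ρ'.adicCompletion p).asModule :=
  Representation.asModuleMap _ _ (adicLimit.map p f) (by
    intro g x
    refine Subtype.ext (funext fun m => ?_)
    change ModPow.map p m f (ρ.modPow p m g (x.1 m)) = ρ'.modPow p m g (ModPow.map p m f (x.1 m))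
    obtain ⟨y, hy⟩ := QuotientAddGroup.mk_surjective (x.1 m)
    rw [← hy]
    exact congrArg QuotientAddGroup.mk (hf g y))

/-- The isomorphism of adic completions induced by an equivariant homomorphism which is an
isomorphism modulo all powers of `p`. -/
noncomputable def Representation.adicEquiv {ρ : Representation A G V}
    {ρ' : Representation B G W} {f : V →+ W} (hf : ∀ g x, f (ρ g x) = ρ' g (f x))
    (h : ∀ m, IsModPowIso p m f) :
    (ρ.adicCompletion p).asModule ≃ₗ[MonoidAlgebra ℤ_[p] G] (ρ'.adicCompletion p).asModule :=
  LinearEquiv.ofBijective (Representation.adicMap p ρ ρ' f hf) (adicLimit.map_bijective p h)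

/-- Adic completion commutes with binary products. -/
noncomputable def Representation.adicProd {V' : Type*} [AddCommGroup V'] [Module A V']
    (ρ : Representation A G V) (ρ' : Representation A G V') :
    ((ρ.prod ρ').adicCompletion p).asModule ≃ₗ[MonoidAlgebra ℤ_[p] G]
      (ρ.adicCompletion p).asModule × (ρ'.adicCompletion p).asModule :=
  LinearEquiv.ofBijective
    ((Representation.adicMap p (ρ.prod ρ') ρ (AddMonoidHom.fst V V') (fun _ _ => rfl)).prod
      (Representation.adicMap p (ρ.prod ρ') ρ' (AddMonoidHom.snd V V') (fun _ _ => rfl))) (by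
    constructor
    · intro x y hxy
      refine Subtype.ext (funext fun m => (Representation.modPowProd p m ρ ρ').injective ?_)
      exact Prod.ext (congrFun (congrArg Subtype.val (congrArg Prod.fst hxy)) m)
        (congrFun (congrArg Subtype.val (congrArg Prod.snd hxy)) m)
    · rintro ⟨y, y'⟩
      refine ⟨adicLimit.map p (AddMonoidHom.inl V V') y +
        adicLimit.map p (AddMonoidHom.inr V V') y', Prod.ext ?_ ?_⟩
      · refine Subtype.ext (funext fun m => ?_)
        change ModPow.map p m (AddMonoidHom.fst V V')
          (ModPow.map p m (AddMonoidHom.inl V V') (y.1 m) +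
            ModPow.map p m (AddMonoidHom.inr V V') (y'.1 m)) = y.1 m
        obtain ⟨v, hv⟩ := QuotientAddGroup.mk_surjective (y.1 m)
        obtain ⟨v', hv'⟩ := QuotientAddGroup.mk_surjective (y'.1 m)
        rw [← hv, ← hv']
        exact congrArg QuotientAddGroup.mk (add_zero v)
      · refine Subtype.ext (funext fun m => ?_)
        change ModPow.map p m (AddMonoidHom.snd V V')
          (ModPow.map p m (AddMonoidHom.inl V V') (y.1 m) +
            ModPow.map p m (AddMonoidHom.inr V V') (y'.1 m)) = y'.1 m
        obtain ⟨v, hv⟩ := QuotientAddGroup.mk_surjective (y.1 m)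
        obtain ⟨v', hv'⟩ := QuotientAddGroup.mk_surjective (y'.1 m)
        rw [← hv, ← hv']
        exact congrArg QuotientAddGroup.mk (zero_add v'))

end AdicFunctor

/-! ### Finitely generated `ℤ_p`-modules are complete -/

section Complete

variable (p : ℕ) [Fact p.Prime] {V : Type*} [AddCommGroup V] [Module ℤ_[p] V]

/-- The canonical map from a `ℤ_p`-module to its completion. -/
noncomputable def toAdicLimit : V →ₗ[ℤ_[p]] adicLimit p V where
  toFun v := ⟨fun _ => QuotientAddGroup.mk v, fun _ _ _ => rfl⟩
  map_add' _ _ := rfl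
  map_smul' a v := Subtype.ext (funext fun m => by
    change (QuotientAddGroup.mk (a • v) : ModPow p m V) =
      PadicInt.toZModPow m a • (QuotientAddGroup.mk v : ModPow p m V)
    obtain ⟨k, hk⟩ := ZMod.intCast_surjective (PadicInt.toZModPow m a)
    have hker : a - (k : ℤ_[p]) ∈ RingHom.ker (PadicInt.toZModPow (p := p) m) := by
      rw [RingHom.mem_ker, map_sub, map_intCast, hk, sub_self]
    rw [PadicInt.ker_toZModPow, Ideal.mem_span_singleton] at hker
    obtain ⟨b, hb⟩ := hker
    rw [← hk, Int.cast_smul_eq_zsmul, ← QuotientAddGroup.mk_zsmul, ← sub_eq_zero,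
      ← QuotientAddGroup.mk_sub, ModPow.mk_eq_zero]
    refine ⟨b • v, ?_⟩
    rw [← Int.cast_smul_eq_zsmul ℤ_[p], ← sub_smul, hb, mul_smul, ← Nat.cast_pow,
      Nat.cast_smul_eq_nsmul])

theorem toAdicLimit_injective [Module.Finite ℤ_[p] V] :
    Function.Injective (toAdicLimit p : V →ₗ[ℤ_[p]] adicLimit p V) := by
  rw [injective_iff_map_eq_zero]
  intro v hv
  -- Krull's intersection theorem for a finitely generated module over a Noetherian local ring.
  have hH : IsHausdorff (IsLocalRing.maximalIdeal ℤ_[p]) V := inferInstance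
  refine hH.haus v fun m => ?_
  rw [SModEq.zero]
  obtain ⟨y, hy⟩ := ModPow.mk_eq_zero.1 (congrFun (congrArg Subtype.val hv) m)
  rw [hy, ← Nat.cast_smul_eq_nsmul ℤ_[p], Nat.cast_pow]
  refine Submodule.smul_mem_smul (Ideal.pow_mem_pow ?_ m) trivial
  rw [PadicInt.maximalIdeal_eq_span_p]
  exact Ideal.mem_span_singleton_self _

/-- The terms with k ≥ m are divisible by p^m, so the series converges. The tail is recorded as an
explicit multiple of p^m so that a linear map can be applied to it. -/
theorem PadicInt.exists_sum_pow_limit (u : ℕ → ℤ_[p]) :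
    ∃ L : ℤ_[p], ∀ m, ∃ b, L - ∑ k ∈ Finset.range m, (p : ℤ_[p]) ^ k * u k = (p : ℤ_[p]) ^ m * b := by
  have hP : IsPrecomplete (IsLocalRing.maximalIdeal ℤ_[p]) ℤ_[p] := inferInstance
  obtain ⟨L, hL⟩ := hP.prec' (fun m => ∑ k ∈ Finset.range m, (p : ℤ_[p]) ^ k * u k) (by
    intro m n hmn
    rw [PadicInt.maximalIdeal_eq_span_p, Ideal.span_singleton_pow, SModEq.comm, SModEq.sub_mem,
      smul_eq_mul, Ideal.mul_top, Ideal.mem_span_singleton, ← Finset.sum_Ico_eq_sub _ hmn]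
    exact Finset.dvd_sum fun k hk => (pow_dvd_pow _ (Finset.mem_Ico.1 hk).1).mul_right _)
  refine ⟨L, fun m => ?_⟩
  have h := (hL m).symm
  rw [PadicInt.maximalIdeal_eq_span_p, Ideal.span_singleton_pow, SModEq.sub_mem,
      smul_eq_mul, Ideal.mul_top, Ideal.mem_span_singleton] at h
  exact h

theorem toAdicLimit_surjective [Module.Finite ℤ_[p] V] :
    Function.Surjective (toAdicLimit p : V →ₗ[ℤ_[p]] adicLimit p V) := by
  intro x
  obtain ⟨n, s, hs⟩ := Module.Finite.exists_fin' ℤ_[p] V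
  choose v hv using fun m => QuotientAddGroup.mk_surjective (x.1 m)
  -- Successive differences are lifted to a finite free module, where the resulting series converges
  -- coordinatewise.
  have hstep (m : ℕ) : ∃ w : Fin n → ℤ_[p], v (m + 1) - v m = p ^ m • s w := by
    have h := x.2 m (m + 1) m.le_succ
    rw [← hv m, ← hv (m + 1)] at h
    change QuotientAddGroup.mk (v (m + 1)) = (QuotientAddGroup.mk (v m) : ModPow p m V) at h
    rw [← sub_eq_zero, ← QuotientAddGroup.mk_sub, ModPow.mk_eq_zero] at h
    obtain ⟨y, hy⟩ := h
    obtain ⟨w, rfl⟩ := hs y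
    exact ⟨w, hy⟩
  choose w hw using hstep
  have hsum (m : ℕ) : v m = v 0 + s (∑ k ∈ Finset.range m, (p : ℤ_[p]) ^ k • w k) := by
    induction m with
    | zero => simp
    | succ m ih =>
      rw [Finset.sum_range_succ, map_add, ← add_assoc, ← ih, map_smul, ← sub_eq_iff_eq_add', hw,
        ← Nat.cast_pow, Nat.cast_smul_eq_nsmul]
  choose L hL using fun i => PadicInt.exists_sum_pow_limit p (fun k => w k i)
  choose b hb using hL
  refine ⟨v 0 + s L, Subtype.ext (funext fun m => ?_)⟩
  rw [← hv m]
  change QuotientAddGroup.mk (v 0 + s L) = (QuotientAddGroup.mk (v m) : ModPow p m V)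
  rw [← sub_eq_zero, ← QuotientAddGroup.mk_sub, ModPow.mk_eq_zero]
  refine ⟨s (fun i => b i m), ?_⟩
  rw [hsum m, add_sub_add_left_eq_sub, ← map_sub, ← map_nsmul]
  congr 1
  ext i
  simpa [Finset.sum_apply] using hb i m

/-- A representation on a finitely generated `ℤ_p`-module is its own completion. -/
noncomputable def Representation.adicSelf {G : Type*} [Group G] [Module.Finite ℤ_[p] V]
    (ρ : Representation ℤ_[p] G V) :
    ρ.asModule ≃ₗ[MonoidAlgebra ℤ_[p] G] (ρ.adicCompletion p).asModule :=
  LinearEquiv.ofBijective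
    (Representation.asModuleMap ρ (ρ.adicCompletion p) (toAdicLimit p) (fun _ _ => rfl))
    ⟨toAdicLimit_injective p, toAdicLimit_surjective p⟩

end Complete

/-! ### Change of coefficients -/

section BaseChange

/-- ℤ meets p^m ℤ_p in p^m ℤ and is dense in ℤ_p. This transfers the integral model to ℤ_p. -/
theorem isModPowIso_intCast (p m : ℕ) [Fact p.Prime] :
    IsModPowIso p m (Int.castRingHom ℤ_[p]).toAddMonoidHom := by
  constructor
  · intro v w hv
    have h : (p : ℤ_[p]) ^ m ∣ (v : ℤ_[p]) := ⟨w, by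
      rw [← Nat.cast_pow, ← nsmul_eq_mul]
      exact hv⟩
    obtain ⟨c, hc⟩ := (PadicInt.pow_p_dvd_int_iff m v).1 h
    exact ⟨c, by rw [hc, nsmul_eq_mul, Nat.cast_pow]⟩
  · intro w
    obtain ⟨c, hc⟩ := Ideal.mem_span_singleton.1 (PadicInt.appr_spec m w)
    refine ⟨(w.appr m : ℤ), c, ?_⟩
    rw [sub_eq_iff_eq_add'] at hc
    rw [nsmul_eq_mul, Nat.cast_pow]
    simpa using hc

/-- The kernel is p^m ℤ_p, and p^m is zero in the target. This identifies the reductions of trivial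
and free modules. -/
theorem isModPowIso_toZModPow (p m : ℕ) [Fact p.Prime] :
    IsModPowIso p m (PadicInt.toZModPow (p := p) m).toAddMonoidHom := by
  constructor
  · intro v w hv
    have h : v ∈ RingHom.ker (PadicInt.toZModPow (p := p) m) := by
      rw [RingHom.mem_ker]
      refine hv.trans ?_
      rw [nsmul_eq_mul, ZMod.natCast_self, zero_mul]
    rw [PadicInt.ker_toZModPow, Ideal.mem_span_singleton] at h
    obtain ⟨c, hc⟩ := h
    exact ⟨c, by rw [hc, nsmul_eq_mul, Nat.cast_pow]⟩
  · intro w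
    obtain ⟨k, rfl⟩ := ZMod.intCast_surjective w
    exact ⟨k, 0, by simp⟩

variable {A B G : Type*} [CommRing A] [CommRing B] [Group G] {f : A →+* B} {p m : ℕ}

theorem IsModPowIso.mapRingHom (h : IsModPowIso p m f.toAddMonoidHom) :
    IsModPowIso p m (MonoidAlgebra.mapRingHom G f).toAddMonoidHom := by
  have h' := h.mapRange G
  constructor
  · intro v w hv
    obtain ⟨v', hv'⟩ := h'.inj v.coeff w.coeff (by
      rw [← MonoidAlgebra.coeff_smul, ← hv]
      ext g
      simp)
    exact ⟨MonoidAlgebra.ofCoeff v', MonoidAlgebra.coeff_injective hv'⟩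
  · intro w
    obtain ⟨v, w', hv⟩ := h'.surj w.coeff
    refine ⟨MonoidAlgebra.ofCoeff v, MonoidAlgebra.ofCoeff w', MonoidAlgebra.coeff_injective ?_⟩
    rw [hv, MonoidAlgebra.coeff_add, MonoidAlgebra.coeff_smul]
    ext g
    simp

variable (f) in
/-- Change of coefficients for trivial modules. -/
noncomputable def trivialRepMap (ι : Type*) : (ι →₀ A) →+ (ι →₀ B) :=
  Finsupp.mapRange.addMonoidHom f.toAddMonoidHom

theorem trivialRepMap_equivariant (ι : Type*) (g : G) (x : ι →₀ A) :
    trivialRepMap f ι (trivialRep A G ι g x) = trivialRep B G ι g (trivialRepMap f ι x) := rfl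

theorem IsModPowIso.trivialRepMap (h : IsModPowIso p m f.toAddMonoidHom) (ι : Type*) :
    IsModPowIso p m (trivialRepMap f ι) := h.mapRange ι

variable (G f) in
/-- Change of coefficients for free modules. -/
noncomputable def freeRepMap (ι : Type*) : (ι →₀ MonoidAlgebra A G) →+ (ι →₀ MonoidAlgebra B G) :=
  Finsupp.mapRange.addMonoidHom (MonoidAlgebra.mapRingHom G f).toAddMonoidHom

theorem ofModule'_apply {M : Type*} [AddCommGroup M] [Module A M]
    [Module (MonoidAlgebra A G) M] [IsScalarTower A (MonoidAlgebra A G) M] (g : G) (x : M) :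
    Representation.ofModule' (k := A) M g x = (MonoidAlgebra.single g 1 : MonoidAlgebra A G) • x :=
  rfl

theorem freeRepMap_equivariant (ι : Type*) (g : G) (x : ι →₀ MonoidAlgebra A G) :
    freeRepMap G f ι (freeRep A G ι g x) = freeRep B G ι g (freeRepMap G f ι x) := by
  ext1 i
  rw [ofModule'_apply, ofModule'_apply]
  simp [freeRepMap]

theorem IsModPowIso.freeRepMap (h : IsModPowIso p m f.toAddMonoidHom) (ι : Type*) :
    IsModPowIso p m (freeRepMap G f ι) := h.mapRingHom.mapRange ι

theorem cyclicRepMap_le (f : A →+* B) (p ν : ℕ) (σ : G) :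
    (Ideal.span {(p : MonoidAlgebra A G) ^ ν * (MonoidAlgebra.of A G σ - 1)}).toAddSubgroup ≤
    AddSubgroup.comap (MonoidAlgebra.mapRingHom G f).toAddMonoidHom
      (Ideal.span {(p : MonoidAlgebra B G) ^ ν * (MonoidAlgebra.of B G σ - 1)}).toAddSubgroup := by
  intro x hx
  obtain ⟨c, rfl⟩ := Submodule.mem_span_singleton.1 hx
  refine Submodule.mem_span_singleton.2 ⟨MonoidAlgebra.mapRingHom G f c, ?_⟩
  simp

variable (f) in
/-- Change of coefficients for cyclic modules. -/
noncomputable def cyclicRepMap (p ν : ℕ) (σ : G) : CyclicModule A p ν σ →+ CyclicModule B p ν σ :=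
  QuotientAddGroup.map _ _ (MonoidAlgebra.mapRingHom G f).toAddMonoidHom (cyclicRepMap_le f p ν σ)

theorem cyclicRepMap_equivariant (ν : ℕ) (σ g : G) (x : CyclicModule A p ν σ) :
    cyclicRepMap f p ν σ (cyclicRep A p ν σ g x) = cyclicRep B p ν σ g (cyclicRepMap f p ν σ x) := by
  obtain ⟨x, rfl⟩ := Submodule.Quotient.mk_surjective _ x
  rw [ofModule'_apply, ofModule'_apply]
  change Submodule.Quotient.mk (MonoidAlgebra.mapRingHom G f (MonoidAlgebra.single g 1 * x)) =
    Submodule.Quotient.mk (MonoidAlgebra.single g 1 * MonoidAlgebra.mapRingHom G f x)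
  simp

/-- The generator of the relation ideal over `A` maps to the generator over `B`, and its
coefficients over `B` lift to `A` up to p^m. -/
theorem IsModPowIso.cyclicRepMap (h : IsModPowIso p m f.toAddMonoidHom) (ν : ℕ) (σ : G) :
    IsModPowIso p m (cyclicRepMap f p ν σ) := by
  refine h.mapRingHom.quotientMap (cyclicRepMap_le f p ν σ) fun w hw => ?_
  obtain ⟨c, rfl⟩ := Submodule.mem_span_singleton.1 hw
  obtain ⟨d, d', rfl⟩ := h.mapRingHom (G := G).surj c
  refine ⟨_, Submodule.mem_span_singleton.2 ⟨d, rfl⟩,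
    d' • ((p : MonoidAlgebra B G) ^ ν * (MonoidAlgebra.of B G σ - 1)), ?_⟩
  simp [add_mul, mul_assoc]

end BaseChange

/-! ### Cyclic modules over the group ring of a group of order two -/

section Indecomposable

/-- The components of the generator are r • x and (1 - r) • x. Over a local ring r or 1 - r is a
unit, so one summand contains the generator and is everything. -/
theorem isIndecomposableModule_of_cyclic {R M : Type*} [Ring R] [IsLocalRing R] [AddCommGroup M]
    [Module R M] [Nontrivial M] (x : M) (hx : ∀ y : M, ∃ r : R, y = r • x) :
    IsIndecomposableModule R M := by
  refine ⟨inferInstance, fun N N' hN => ?_⟩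
  have htop (P : Submodule R M) (h : x ∈ P) : P = ⊤ := by
    rw [eq_top_iff]
    intro y _
    obtain ⟨r, rfl⟩ := hx y
    exact P.smul_mem r h
  obtain ⟨n, hn, n', hn', hnn⟩ := Submodule.mem_sup.1 (hN.sup_eq_top ▸ trivial : x ∈ N ⊔ N')
  obtain ⟨r, rfl⟩ := hx n
  have h' : n' = (1 - r) • x := by rw [sub_smul, one_smul, eq_sub_iff_add_eq', hnn]
  rcases IsLocalRing.isUnit_or_isUnit_of_add_one (add_sub_cancel r 1) with h | h
  · right
    have : N = ⊤ := htop N ((Submodule.smul_mem_iff_of_isUnit N h).1 hn)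
    rw [this] at hN
    exact eq_bot_of_top_isCompl hN
  · left
    have : N' = ⊤ := htop N' ((Submodule.smul_mem_iff_of_isUnit N' h).1 (h' ▸ hn'))
    rw [this] at hN
    exact eq_bot_of_isCompl_top hN

variable {A G : Type*} [CommRing A] [Group G] {σ : G}

theorem MonoidAlgebra.eq_single_add_single (hσ : σ ≠ 1) (hG : ∀ τ : G, τ = 1 ∨ τ = σ)
    (r : MonoidAlgebra A G) : r = single 1 (r.coeff 1) + single σ (r.coeff σ) := by
  classical
  ext τ
  rcases hG τ with rfl | rfl <;> simp [hσ, hσ.symm]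

/-- An element a + bσ is a unit as soon as its augmentation a + b is: (a + bσ)(a - bσ) = (a + b)(a -
b), and a - b differs from a + b by 2b, which lies in the maximal ideal. -/
theorem MonoidAlgebra.isLocalRing_of_order_two [IsLocalRing A] (h2 : ¬ IsUnit (2 : A))
    (hσ : σ ≠ 1) (hG : ∀ τ : G, τ = 1 ∨ τ = σ) (hσσ : σ * σ = 1) :
    IsLocalRing (MonoidAlgebra A G) := by
  have hunit (a b : A) (h : IsUnit (a + b)) :
      IsUnit (single 1 a + single σ b : MonoidAlgebra A G) := by
    have h' : IsUnit (a - b) := by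
      have : ¬ IsUnit (2 * b) := fun h => h2 (isUnit_of_mul_isUnit_left h)
      rw [show a + b = (a - b) + 2 * b by ring] at h
      exact (IsLocalRing.isUnit_or_isUnit_of_isUnit_add h).resolve_right this
    obtain ⟨c, hc⟩ := (h.mul h').exists_right_inv
    have hab : (a + b) * (a - b) = a * a - b * b := by ring
    have e1 : (single 1 a + single σ b : MonoidAlgebra A G) * (single 1 a - single σ b) =
        single 1 ((a + b) * (a - b)) := by
      rw [hab, single_sub]
      simp only [add_mul, mul_sub, single_mul_single, one_mul, mul_one, hσσ, mul_comm b a]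
      abel
    have e2 : (single 1 a - single σ b : MonoidAlgebra A G) * (single 1 a + single σ b) =
        single 1 ((a + b) * (a - b)) := by
      rw [hab, single_sub]
      simp only [mul_add, sub_mul, single_mul_single, one_mul, mul_one, hσσ, mul_comm b a]
      abel
    have hl : (single 1 a + single σ b : MonoidAlgebra A G) *
        ((single 1 a - single σ b) * single 1 c) = 1 := by
      rw [← mul_assoc, e1, single_mul_single, hc, one_mul, one_def]
    have hr : (single 1 c * (single 1 a - single σ b)) *
        (single 1 a + single σ b : MonoidAlgebra A G) = 1 := by
      rw [mul_assoc, e2, single_mul_single, mul_comm c, hc, one_mul, one_def]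
    exact isUnit_iff_exists.2 ⟨_, hl, left_inv_eq_right_inv hr hl ▸ hr⟩
  have : Nontrivial (MonoidAlgebra A G) := inferInstance
  refine ⟨fun {r s} hrs => ?_⟩
  have h1 : (r.coeff 1 + r.coeff σ) + (s.coeff 1 + s.coeff σ) = 1 := by
    have e1 := congrArg (fun x => x.coeff 1) hrs
    have e2 := congrArg (fun x => x.coeff σ) hrs
    simp [MonoidAlgebra.one_def, hσ] at e1 e2
    linear_combination e1 + e2
  rw [eq_single_add_single hσ hG r, eq_single_add_single hσ hG s]
  exact (IsLocalRing.isUnit_or_isUnit_of_add_one h1).imp (hunit _ _) (hunit _ _)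

/-- The augmentation vanishes on `p ^ ν (σ - 1)`. -/
theorem augmentation_eq_zero {p ν : ℕ} {x : MonoidAlgebra A G}
    (hx : x ∈ Ideal.span {(p : MonoidAlgebra A G) ^ ν * (MonoidAlgebra.of A G σ - 1)}) :
    MonoidAlgebra.lift A A G 1 x = 0 := by
  obtain ⟨c, rfl⟩ := Submodule.mem_span_singleton.1 hx
  simp

theorem nontrivial_cyclicModule [Nontrivial A] (p ν : ℕ) (σ : G) :
    Nontrivial (CyclicModule A p ν σ) := by
  rw [Submodule.Quotient.nontrivial_iff]
  intro h
  have := augmentation_eq_zero (h.symm ▸ Submodule.mem_top : (1 : MonoidAlgebra A G) ∈ Ideal.span _)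
  simp at this

theorem isIndecomposableModule_cyclicModule [IsLocalRing A] (h2 : ¬ IsUnit (2 : A))
    (hσ : σ ≠ 1) (hG : ∀ τ : G, τ = 1 ∨ τ = σ) (hσσ : σ * σ = 1) (p ν : ℕ) :
    IsIndecomposableModule (MonoidAlgebra A G) (CyclicModule A p ν σ) := by
  have := MonoidAlgebra.isLocalRing_of_order_two h2 hσ hG hσσ
  have := nontrivial_cyclicModule (A := A) p ν σ
  refine isIndecomposableModule_of_cyclic (Submodule.Quotient.mk 1) fun y => ?_
  obtain ⟨r, rfl⟩ := Submodule.Quotient.mk_surjective _ y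
  exact ⟨r, by rw [← Submodule.Quotient.mk_smul, smul_eq_mul, mul_one]⟩

/-- The class of 1 generates the reduction over the local ring (ℤ/2^m)G. It is nonzero because the
augmentation kills the relation, while 1 is not a multiple of 2^m in ℤ_2. -/
theorem isIndecomposableModule_modPow_cyclicModule (hσ : σ ≠ 1) (hG : ∀ τ : G, τ = 1 ∨ τ = σ)
    (hσσ : σ * σ = 1) (ν : ℕ) {m : ℕ} (hm : 1 ≤ m) :
    IsIndecomposableModule (MonoidAlgebra (ZMod (2 ^ m)) G)
      ((cyclicRep ℤ_[2] 2 ν σ).modPow 2 m).asModule := by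
  have : Fact (1 < 2 ^ m) := ⟨Nat.one_lt_two_pow (by omega)⟩
  have hloc : IsLocalRing (ZMod (2 ^ m)) :=
    IsLocalRing.of_surjective' (PadicInt.toZModPow (p := 2) m) fun x => by
      obtain ⟨k, rfl⟩ := ZMod.intCast_surjective x
      exact ⟨k, by simp⟩
  have h2 : ¬ IsUnit (2 : ZMod (2 ^ m)) := by
    intro h
    have h0 : (2 : ZMod (2 ^ m)) ^ m = 0 := by exact_mod_cast ZMod.natCast_self (2 ^ m)
    exact not_isUnit_zero (h0 ▸ h.pow m)
  have := MonoidAlgebra.isLocalRing_of_order_two h2 hσ hG hσσ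
  let x : ModPow 2 m (CyclicModule ℤ_[2] 2 ν σ) := QuotientAddGroup.mk (Submodule.Quotient.mk 1)
  have hnt : Nontrivial ((cyclicRep ℤ_[2] 2 ν σ).modPow 2 m).asModule := by
    refine ⟨x, 0, fun h => ?_⟩
    obtain ⟨y, hy⟩ := ModPow.mk_eq_zero.1 h
    obtain ⟨y, rfl⟩ := Submodule.Quotient.mk_surjective _ y
    rw [← Submodule.Quotient.mk_smul, ← sub_eq_zero, ← Submodule.Quotient.mk_sub,
      Submodule.Quotient.mk_eq_zero] at hy
    have h := augmentation_eq_zero hy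
    rw [map_sub, map_one, map_nsmul, sub_eq_zero, nsmul_eq_mul, Nat.cast_pow] at h
    have : IsUnit ((2 : ℕ) : ℤ_[2]) := by
      refine (isUnit_pow_iff (by omega : m ≠ 0)).1 (IsUnit.of_mul_eq_one _ h.symm)
    exact (PadicInt.prime_p (p := 2)).not_isUnit this
  let q : MonoidAlgebra ℤ_[2] G →+ ((cyclicRep ℤ_[2] 2 ν σ).modPow 2 m).asModule :=
    (QuotientAddGroup.mk' (powSubgroup 2 m (CyclicModule ℤ_[2] 2 ν σ))).comp
      (Submodule.mkQ (Ideal.span {((2 : ℕ) : MonoidAlgebra ℤ_[2] G) ^ ν *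
        (MonoidAlgebra.of ℤ_[2] G σ - 1)})).toAddMonoidHom
  have hq : Function.Surjective q :=
    (QuotientAddGroup.mk'_surjective _).comp (Submodule.mkQ_surjective _)
  have hsingle (g : G) (a : ℤ_[2]) : q (MonoidAlgebra.single g a) =
      (MonoidAlgebra.single g (PadicInt.toZModPow m a) : MonoidAlgebra (ZMod (2 ^ m)) G) • q 1 := by
    rw [Representation.single_smul]
    -- Component m of the linearity of `toAdicLimit` says that ℤ_2 acts on the reduction through
    -- ℤ/2^m.
    have h := congrFun (congrArg Subtype.val ((toAdicLimit 2).map_smul a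
      (cyclicRep ℤ_[2] 2 ν σ g (Submodule.Quotient.mk 1)))) m
    refine Eq.trans ?_ h
    refine congrArg QuotientAddGroup.mk ?_
    rw [ofModule'_apply, ← Submodule.Quotient.mk_smul, ← Submodule.Quotient.mk_smul]
    simp
  refine isIndecomposableModule_of_cyclic (q 1) fun y => ?_
  obtain ⟨r, rfl⟩ := hq y
  induction r using MonoidAlgebra.induction_linear with
  | zero => exact ⟨0, by rw [map_zero, zero_smul]⟩
  | add r s hr hs =>
    obtain ⟨c, hc⟩ := hr
    obtain ⟨d, hd⟩ := hs
    exact ⟨c + d, by rw [map_add, add_smul, ← hc, ← hd]⟩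
  | single g a => exact ⟨_, hsingle g a⟩

end Indecomposable

/-! ### Quadratic extensions, additively -/

section Quadratic

open Finsupp

/-- A criterion for classes of `f i`, `x j` and `s (x j)` to be a basis of `L / 2`, where `L` is an
abelian group with an involution `s`, modelled on the units of a quadratic extension: `E` plays the
role of the units of the base field, `n` is the norm and `a` becomes a square in `L`. -/
theorem isModPowIso_two_one_of_norm {E L : Type*} [AddCommGroup E] [AddCommGroup L]
    (s : L →+ L) (j : E →+ L) (n : L →+ E) (a : E)
    (hjn : ∀ y, j (n y) = y + s y) (hnj : ∀ e, n (j e) = 2 • e) (hns : ∀ y, n (s y) = n y)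
    (h90 : ∀ y, n y = 0 → ∃ w, y = s w - w) (hja : ∃ d, j a = 2 • d)
    (hj : ∀ e y, j e = 2 • y → ∃ e', e = 2 • e' ∨ e = a + 2 • e') (han : ∀ y, a ≠ n y)
    {ι J : Type*} (f : ι → E) (x : J → L)
    (hf : ∀ e, ∃ (c : ι →₀ ℤ) (k : ℤ) (y : L), e = linearCombination ℤ f c + k • a + n y)
    (hf' : ∀ (c : ι →₀ ℤ) (k : ℤ) (y : L), linearCombination ℤ f c + k • a = n y →
      ∃ c' : ι →₀ ℤ, c = 2 • c')
    (hx : ∀ y, ∃ (u : J →₀ ℤ) (e : E), n y = n (linearCombination ℤ x u) + 2 • e)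
    (hx' : ∀ (u : J →₀ ℤ) (e : E), n (linearCombination ℤ x u) = 2 • e →
      ∃ u' : J →₀ ℤ, u = 2 • u') :
    IsModPowIso 2 1 ((linearCombination ℤ (fun i => j (f i))).toAddMonoidHom.coprod
      ((linearCombination ℤ x).toAddMonoidHom.coprod
        (s.comp (linearCombination ℤ x).toAddMonoidHom))) := by
  have hjf (c : ι →₀ ℤ) : linearCombination ℤ (fun i => j (f i)) c = j (linearCombination ℤ f c) :=
    (map_finsuppSum j c _).trans (by simp [linearCombination_apply]) |>.symm
  obtain ⟨d, hd⟩ := hja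
  constructor
  · rintro ⟨c, u, v⟩ y hy
    simp only [AddMonoidHom.coprod_apply, LinearMap.toAddMonoidHom_coe, AddMonoidHom.comp_apply,
      hjf, pow_one] at hy ⊢
    have h1 := congrArg n hy
    simp only [map_add, hnj, hns, map_nsmul] at h1
    -- The norm cannot tell x from s x, so it shows that u + v is even.
    obtain ⟨u', hu'⟩ := hx' (u + v) (n y - linearCombination ℤ f c) (by
      rw [map_add, map_add, smul_sub, ← h1]; abel)
    obtain rfl : v = 2 • u' - u := by rw [← hu']; abel
    -- As v ≡ -u modulo 2, what remains is x(u) - s x(u), which differs from j(n(x(u))) by twice s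
    -- x(u). The relation therefore comes from `E`.
    have h2 : j (linearCombination ℤ f c + n (linearCombination ℤ x u)) =
        2 • (y - s (linearCombination ℤ x u') + s (linearCombination ℤ x u)) := by
      rw [map_add, hjn, smul_add, smul_sub, ← hy]
      simp only [map_sub, map_nsmul]
      abel
    have h3 : ∃ (e : E) (k : ℤ), linearCombination ℤ f c + n (linearCombination ℤ x u) =
        k • a + 2 • e := by
      obtain ⟨e, he | he⟩ := hj _ _ h2
      · exact ⟨e, 0, by simpa using he⟩
      · exact ⟨e, 1, by simpa using he⟩
    obtain ⟨e, k, he⟩ := h3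
    -- Since 2e is the norm of j e, the element f(c) - k a is a norm.
    obtain ⟨c', rfl⟩ := hf' c (-k) (j e - linearCombination ℤ x u) (by
      rw [map_sub, hnj, neg_smul, ← sub_eq_add_neg, sub_eq_sub_iff_add_eq_add, he]; abel)
    obtain ⟨u'', rfl⟩ : ∃ u'' : J →₀ ℤ, u = 2 • u'' := by
      obtain ⟨e, he | he⟩ := hj _ _ h2
      · refine hx' u (e - linearCombination ℤ f c') ?_
        rw [smul_sub, ← he, map_nsmul]; abel
      -- With `c` even, this alternative would exhibit `a` as a norm.
      · refine absurd ?_ (han (linearCombination ℤ x u + j (linearCombination ℤ f c' - e)))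
        rw [map_add, hnj, smul_sub, eq_comm, ← map_nsmul, ← add_sub_assoc, sub_eq_iff_eq_add, ← he]
        abel
    exact ⟨(c', u'', u' - u''), by simp [smul_sub]⟩
  · intro y
    simp only [AddMonoidHom.coprod_apply, LinearMap.toAddMonoidHom_coe, AddMonoidHom.comp_apply,
      hjf, pow_one]
    obtain ⟨u₁, e₁, h₁⟩ := hx y
    obtain ⟨w, hw⟩ := h90 (y - linearCombination ℤ x u₁ - j e₁) (by
      rw [map_sub, map_sub, hnj, h₁]; abel)
    -- Modulo 2, s w - w agrees with w + s w = j(n w), so only the norm of `w` matters.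
    obtain ⟨u₂, e₂, h₂⟩ := hx w
    obtain ⟨c, k, z, hz⟩ := hf e₁
    obtain ⟨u₃, e₃, h₃⟩ := hx z
    have hw' : s w = linearCombination ℤ x u₂ + s (linearCombination ℤ x u₂) + 2 • j e₂ - w := by
      rw [eq_sub_iff_add_eq', ← hjn, ← hjn, h₂, map_add, map_nsmul]
    -- In `L` the coefficient of `a` becomes even, and the norm of `z` becomes a sum of terms x + s
    -- x.
    have he₁ : j e₁ = j (linearCombination ℤ f c) + k • (2 • d) +
        (linearCombination ℤ x u₃ + s (linearCombination ℤ x u₃) + 2 • j e₃) := by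
      rw [hz, map_add, map_add, map_zsmul, hd, h₃, map_add, map_nsmul, hjn]
    refine ⟨(c, u₁ + u₂ + u₃, u₂ + u₃), k • d + j e₃ + j e₂ - w, ?_⟩
    rw [sub_sub, sub_eq_iff_eq_add, hw'] at hw
    rw [hw, he₁]
    simp only [map_add]
    module

end Quadratic

/-! ### Maps from sums of cyclic modules -/

section CyclicSums

open Finsupp

variable {G L : Type*} [Group G] [AddCommGroup L]

/-- The homomorphism `ℤ^ι → L` with prescribed values on the basis. -/
noncomputable def trivialSumMap {ι : Type*} (f : ι → L) : (ι →₀ ℤ) →+ L :=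
  (linearCombination ℤ f).toAddMonoidHom

/-- The equivariant homomorphism `(ℤ G)^J → L` with prescribed values on the basis. -/
noncomputable def freeSumMap (ρ : Representation ℤ G L) {J : Type*} (x : J → L) :
    (J →₀ MonoidAlgebra ℤ G) →+ L :=
  (linearCombination (MonoidAlgebra ℤ G) (M := ρ.asModule) x).toAddMonoidHom

theorem asModule_single_one_smul (ρ : Representation ℤ G L) (g : G) (y : ρ.asModule) :
    (MonoidAlgebra.single g 1 : MonoidAlgebra ℤ G) • y = ρ g (ρ.asModuleEquiv y) := by
  rw [Representation.single_smul, one_smul]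

theorem trivialSumMap_equivariant (ρ : Representation ℤ G L) {ι : Type*} {f : ι → L}
    (hf : ∀ g i, ρ g (f i) = f i) (g : G) (c : ι →₀ ℤ) :
    trivialSumMap f (trivialRep ℤ G ι g c) = ρ g (trivialSumMap f c) := by
  change linearCombination ℤ f c = ρ g (linearCombination ℤ f c)
  rw [linearCombination_apply, map_finsuppSum]
  simp [hf]

theorem freeSumMap_equivariant (ρ : Representation ℤ G L) {J : Type*} (x : J → L) (g : G)
    (k : J →₀ MonoidAlgebra ℤ G) :
    freeSumMap ρ x (freeRep ℤ G J g k) = ρ g (freeSumMap ρ x k) := by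
  rw [ofModule'_apply]
  exact (map_smul (linearCombination (MonoidAlgebra ℤ G) (M := ρ.asModule) x) _ _).trans
    (asModule_single_one_smul ρ g _)

theorem freeSumMap_mapRange (ρ : Representation ℤ G L) {J : Type*} (x : J → L) (g : G)
    (u : J →₀ ℤ) :
    freeSumMap ρ x (mapRange.addMonoidHom (MonoidAlgebra.singleAddHom g) u) =
      ρ g (linearCombination ℤ x u) := by
  induction u using Finsupp.induction_linear with
  | zero => simp
  | add u v hu hv => rw [map_add, map_add, map_add, map_add, hu, hv]
  | single i c =>
    rw [mapRange.addMonoidHom_apply, mapRange_single, linearCombination_single]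
    refine (linearCombination_single (M := ρ.asModule) (MonoidAlgebra ℤ G) _ _).trans ?_
    rw [map_zsmul]
    exact Representation.single_smul ρ c g _

/-- As an abelian group (ℤG)^J is two copies of ℤ^J, given by the coefficients of 1 and σ. This
turns a basis x_j, σx_j into a free ℤG-module. -/
theorem isModPowIso_sum_of_involution {ρ : Representation ℤ G L} {σ : G} (hσ : σ ≠ 1)
    (hG : ∀ τ : G, τ = 1 ∨ τ = σ) {ι J : Type*} {f : ι → L} {x : J → L} {p m : ℕ}
    (h : IsModPowIso p m ((linearCombination ℤ f).toAddMonoidHom.coprod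
      ((linearCombination ℤ x).toAddMonoidHom.coprod
        ((ρ σ).toAddMonoidHom.comp (linearCombination ℤ x).toAddMonoidHom)))) :
    IsModPowIso p m ((trivialSumMap f).coprod (freeSumMap ρ x)) := by
  let θ : (J →₀ ℤ) × (J →₀ ℤ) →+ (J →₀ MonoidAlgebra ℤ G) :=
    (mapRange.addMonoidHom (MonoidAlgebra.singleAddHom 1)).coprod
      (mapRange.addMonoidHom (MonoidAlgebra.singleAddHom σ))
  refine IsModPowIso.of_comp_surjective (g := (AddMonoidHom.id (ι →₀ ℤ)).prodMap θ) ?_ ?_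
  · have e : ((trivialSumMap f).coprod (freeSumMap ρ x)).comp
        ((AddMonoidHom.id (ι →₀ ℤ)).prodMap θ) =
        (linearCombination ℤ f).toAddMonoidHom.coprod ((linearCombination ℤ x).toAddMonoidHom.coprod
          ((ρ σ).toAddMonoidHom.comp (linearCombination ℤ x).toAddMonoidHom)) := by
      refine AddMonoidHom.ext fun y => ?_
      have e₁ : θ y.2 = mapRange.addMonoidHom (MonoidAlgebra.singleAddHom 1) y.2.1 +
        mapRange.addMonoidHom (MonoidAlgebra.singleAddHom σ) y.2.2 := rfl
      have e₂ : freeSumMap ρ x (θ y.2) =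
          linearCombination ℤ x y.2.1 + ρ σ (linearCombination ℤ x y.2.2) := by
        rw [e₁, map_add, freeSumMap_mapRange, freeSumMap_mapRange, map_one, Module.End.one_apply]
      exact congrArg (linearCombination ℤ f y.1 + ·) e₂
    rw [e]
    exact h
  · rintro ⟨c, k⟩
    refine ⟨(c, mapRange (fun r => r.coeff 1) rfl k, mapRange (fun r => r.coeff σ) rfl k),
      Prod.ext rfl ?_⟩
    ext1 i
    exact (MonoidAlgebra.eq_single_add_single hσ hG (k i)).symm

theorem asModule_cyclic_relation_smul (ρ : Representation ℤ G L) (p ν : ℕ) (σ : G)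
    (β : ρ.asModule) : ((p : MonoidAlgebra ℤ G) ^ ν * (MonoidAlgebra.of ℤ G σ - 1)) • β =
      ρ.asModuleEquiv.symm (p ^ ν • (ρ σ (ρ.asModuleEquiv β) - ρ.asModuleEquiv β)) := by
  rw [mul_smul, sub_smul, one_smul, MonoidAlgebra.of_apply, asModule_single_one_smul,
    ← Nat.cast_pow, Nat.cast_smul_eq_nsmul]
  rfl

/-- The homomorphism from the cyclic module `ℤ G / ⟨p ^ ν (σ - 1)⟩` to `L` given by `α`. -/
noncomputable def cyclicMap (ρ : Representation ℤ G L) (p ν : ℕ) (σ : G) (α : L)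
    (hα : p ^ ν • (ρ σ α - α) = 0) : CyclicModule ℤ p ν σ →+ L :=
  (Submodule.liftQ _ (LinearMap.toSpanSingleton (MonoidAlgebra ℤ G) ρ.asModule
    (ρ.asModuleEquiv.symm α)) (by
    rw [Ideal.span, Submodule.span_le, Set.singleton_subset_iff, SetLike.mem_coe,
      LinearMap.mem_ker, LinearMap.toSpanSingleton_apply, asModule_cyclic_relation_smul,
      LinearEquiv.apply_symm_apply, hα, map_zero]) :
    CyclicModule ℤ p ν σ →ₗ[MonoidAlgebra ℤ G] ρ.asModule).toAddMonoidHom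

theorem cyclicMap_mk (ρ : Representation ℤ G L) {p ν : ℕ} {σ : G} {α : L}
    (hα : p ^ ν • (ρ σ α - α) = 0) (r : MonoidAlgebra ℤ G) :
    cyclicMap ρ p ν σ α hα (Submodule.Quotient.mk r) =
      ρ.asModuleEquiv (r • ρ.asModuleEquiv.symm α) := rfl

theorem cyclicMap_relation (ρ : Representation ℤ G L) {p ν : ℕ} {σ : G} {α : L}
    (hα : p ^ ν • (ρ σ α - α) = 0) (k : ℕ) :
    cyclicMap ρ p ν σ α hα (Submodule.Quotient.mk
      ((p : MonoidAlgebra ℤ G) ^ k * (MonoidAlgebra.of ℤ G σ - 1))) = p ^ k • (ρ σ α - α) := by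
  rw [cyclicMap_mk, asModule_cyclic_relation_smul, LinearEquiv.apply_symm_apply,
    LinearEquiv.apply_symm_apply]

theorem cyclicMap_equivariant (ρ : Representation ℤ G L) {p ν : ℕ} {σ : G} {α : L}
    (hα : p ^ ν • (ρ σ α - α) = 0) (g : G) (y : CyclicModule ℤ p ν σ) :
    cyclicMap ρ p ν σ α hα (cyclicRep ℤ p ν σ g y) = ρ g (cyclicMap ρ p ν σ α hα y) := by
  obtain ⟨r, rfl⟩ := Submodule.Quotient.mk_surjective _ y
  rw [ofModule'_apply, ← Submodule.Quotient.mk_smul, cyclicMap_mk, cyclicMap_mk, smul_assoc,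
    asModule_single_one_smul]
  rfl

/-- The relation 2^ν(σ-1), or its analogue for p, already holds for the distinguished generator. The
map therefore factors through the quotient of its free summand. -/
theorem isModPowIso_sum_option {ρ : Representation ℤ G L} {σ : G} {ι J : Type*} {f : ι → L}
    {x : Option J → L} {p m ν : ℕ} (hα : p ^ ν • (ρ σ (x none) - x none) = 0)
    (h : IsModPowIso p m ((trivialSumMap f).coprod (freeSumMap ρ x))) :
    IsModPowIso p m ((cyclicMap ρ p ν σ (x none) hα).coprod
      ((trivialSumMap f).coprod (freeSumMap ρ (x ∘ some)))) := by
  let π : (ι →₀ ℤ) × (Option J →₀ MonoidAlgebra ℤ G) →+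
      CyclicModule ℤ p ν σ × (ι →₀ ℤ) × (J →₀ MonoidAlgebra ℤ G) :=
    { toFun := fun y => (Submodule.Quotient.mk (y.2 none), y.1, y.2.some)
      map_zero' := by simp
      map_add' := fun y z => by simp }
  refine IsModPowIso.of_comp_surjective (g := π) ?_ ?_
  · convert h using 1
    refine AddMonoidHom.ext fun ⟨c, k⟩ => ?_
    have e := linearCombination_option (R := MonoidAlgebra ℤ G) (M := ρ.asModule) x k
    change cyclicMap ρ p ν σ (x none) hα (Submodule.Quotient.mk (k none)) +
      (trivialSumMap f c + freeSumMap ρ (x ∘ some) k.some) = trivialSumMap f c + freeSumMap ρ x k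
    rw [add_left_comm]
    exact congrArg (trivialSumMap f c + ·) e.symm
  · rintro ⟨y, c, k⟩
    obtain ⟨r, rfl⟩ := Submodule.Quotient.mk_surjective _ y
    refine ⟨(c, (optionEquiv (M := MonoidAlgebra ℤ G)).symm (r, k)), ?_⟩
    have e := (optionEquiv (M := MonoidAlgebra ℤ G) (α := J)).apply_symm_apply (r, k)
    exact congrArg (fun z : MonoidAlgebra ℤ G × (J →₀ MonoidAlgebra ℤ G) =>
      ((Submodule.Quotient.mk z.1 : CyclicModule ℤ p ν σ), c, z.2)) e

end CyclicSums

/-! ### Bases of quotients of groups of units -/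

section Bases

open Finsupp

theorem exists_basis_option {k V : Type*} [Field k] [AddCommGroup V] [Module k V] {v : V}
    (hv : v ≠ 0) : ∃ (ι : Set V) (b : Module.Basis (Option ι) k V), b none = v := by
  classical
  have hli : LinearIndepOn k id ({v} : Set V) := LinearIndepOn.singleton hv
  let b := Module.Basis.extend hli
  have hvm : v ∈ hli.extend (Set.subset_univ _) := hli.subset_extend _ rfl
  let S : Set V := hli.extend (Set.subset_univ _)
  let e : Option (S \ {v} : Set V) ≃ S :=
    (Equiv.optionCongr
      { toFun := fun y => ⟨⟨y.1, y.2.1⟩, fun h => y.2.2 (congrArg Subtype.val h)⟩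
        invFun := fun y => ⟨y.1.1, y.1.2, fun h => y.2 (Subtype.ext h)⟩
        left_inv := fun _ => rfl
        right_inv := fun _ => rfl }).trans (Equiv.optionSubtypeNe (⟨v, hvm⟩ : S))
  refine ⟨S \ {v}, b.reindex e.symm, ?_⟩
  rw [Module.Basis.reindex_apply]
  exact Module.Basis.extend_apply_self hli _

/-- Coordinates over ℤ/p are lifted to integers; the model is integral, so bases modulo p are used
through integer combinations. -/
theorem ZMod.exists_linearCombination_of_basis {p : ℕ} [Fact p.Prime] {E Q J : Type*}
    [AddCommGroup E] [AddCommGroup Q] [Module (ZMod p) Q] (q : E →+ Q)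
    (b : Module.Basis J (ZMod p) Q) (x : J → E) (hx : ∀ i, q (x i) = b i) :
    (∀ e, ∃ u : J →₀ ℤ, q (e - linearCombination ℤ x u) = 0) ∧
      ∀ u : J →₀ ℤ, q (linearCombination ℤ x u) = 0 → ∃ u' : J →₀ ℤ, u = p • u' := by
  have key (u : J →₀ ℤ) : q (linearCombination ℤ x u) =
      linearCombination (ZMod p) b (mapRange.addMonoidHom (Int.castAddHom (ZMod p)) u) := by
    induction u using Finsupp.induction_linear with
    | zero => simp
    | add u v hu hv => rw [map_add, map_add, map_add, map_add, hu, hv]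
    | single i c => simp [hx, Int.cast_smul_eq_zsmul]
  constructor
  · intro e
    choose g hg using fun i => ZMod.intCast_surjective (b.repr (q e) i)
    classical
    refine ⟨onFinset (b.repr (q e)).support (fun i => if b.repr (q e) i = 0 then 0 else g i) (by
      intro i hi
      rw [mem_support_iff]
      intro h0
      simp [h0] at hi), ?_⟩
    rw [map_sub, key, sub_eq_zero]
    refine (b.linearCombination_repr (q e)).symm.trans (congrArg _ ?_)
    ext i
    by_cases h0 : b.repr (q e) i = 0
    · simp [h0]
    · simp [h0, hg]
  · intro u hu
    rw [key] at hu
    have h0 := b.linearIndependent.finsuppLinearCombination_injective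
      (hu.trans (map_zero (linearCombination (ZMod p) b)).symm)
    have hdvd (i : J) : (p : ℤ) ∣ u i := by
      rw [← ZMod.intCast_zmod_eq_zero_iff_dvd]
      simpa using DFunLike.congr_fun h0 i
    refine ⟨mapRange (fun c => c / (p : ℤ)) (by simp) u, ?_⟩
    ext i
    simp [Int.mul_ediv_cancel' (hdvd i)]

variable {F : Type u} [Field F]

/-- The projection from `A` to `A / B`. -/
def UnitQuotient.mk (A B : Subgroup Fˣ) : Additive A →+ UnitQuotient A B :=
  (QuotientGroup.mk' (B.subgroupOf A)).toAdditive

theorem UnitQuotient.mk_surjective (A B : Subgroup Fˣ) : Function.Surjective (UnitQuotient.mk A B) :=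
  QuotientGroup.mk'_surjective (B.subgroupOf A)

theorem UnitQuotient.mk_eq_zero {A B : Subgroup Fˣ} (a : Additive A) :
    UnitQuotient.mk A B a = 0 ↔ ((Additive.toMul a : A) : Fˣ) ∈ B := by
  refine Iff.trans ?_ (QuotientGroup.eq_one_iff (N := B.subgroupOf A) (Additive.toMul a))
  exact Iff.rfl

/-- Units `x j ∈ A` are a basis of `A / B` modulo `p`. -/
structure IsUnitBasis (p : ℕ) (A B : Subgroup Fˣ) {J : Type*} (x : J → Additive Fˣ) : Prop where
  mem : ∀ i, Additive.toMul (x i) ∈ A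
  span : ∀ e : Additive Fˣ, Additive.toMul e ∈ A →
    ∃ u : J →₀ ℤ, Additive.toMul (e - linearCombination ℤ x u) ∈ B
  indep : ∀ u : J →₀ ℤ, Additive.toMul (linearCombination ℤ x u) ∈ B → ∃ u' : J →₀ ℤ, u = p • u'

theorem isUnitBasis_of_basis {p : ℕ} [Fact p.Prime] {A B : Subgroup Fˣ}
    [Module (ZMod p) (UnitQuotient A B)] {J : Type*}
    (b : Module.Basis J (ZMod p) (UnitQuotient A B)) (x : J → Additive A)
    (hx : ∀ i, UnitQuotient.mk A B (x i) = b i) :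
    IsUnitBasis p A B (fun i => A.subtype.toAdditive (x i)) := by
  obtain ⟨h1, h2⟩ := ZMod.exists_linearCombination_of_basis (UnitQuotient.mk A B) b x hx
  have hs (u : J →₀ ℤ) : linearCombination ℤ (fun i => A.subtype.toAdditive (x i)) u =
      A.subtype.toAdditive (linearCombination ℤ x u) := by
    rw [linearCombination_apply, linearCombination_apply, map_finsuppSum]
    simp
  refine ⟨fun i => (Additive.toMul (x i)).2, fun e he => ?_, fun u hu => ?_⟩
  · obtain ⟨u, hu⟩ := h1 (Additive.ofMul ⟨Additive.toMul e, he⟩)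
    refine ⟨u, ?_⟩
    rw [UnitQuotient.mk_eq_zero] at hu
    rw [hs]
    exact hu
  · rw [hs] at hu
    exact h2 u ((UnitQuotient.mk_eq_zero _).2 hu)

theorem exists_isUnitBasis_of_basis {p : ℕ} [Fact p.Prime] {A B : Subgroup Fˣ}
    [Module (ZMod p) (UnitQuotient A B)] {J : Type*}
    (b : Module.Basis J (ZMod p) (UnitQuotient A B)) :
    ∃ x : J → Additive Fˣ, IsUnitBasis p A B x := by
  choose x hx using fun i => UnitQuotient.mk_surjective A B (b i)
  exact ⟨_, isUnitBasis_of_basis b x hx⟩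

theorem exists_isUnitBasis_of_basis_option {p : ℕ} [Fact p.Prime] {A B : Subgroup Fˣ}
    [Module (ZMod p) (UnitQuotient A B)] {J : Type*} {a : Additive A}
    (b : Module.Basis (Option J) (ZMod p) (UnitQuotient A B))
    (hb : b none = UnitQuotient.mk A B a) :
    ∃ x : Option J → Additive Fˣ, IsUnitBasis p A B x ∧ x none = A.subtype.toAdditive a := by
  choose x hx using fun i => UnitQuotient.mk_surjective A B (b (some i))
  refine ⟨_, isUnitBasis_of_basis b (fun i => i.elim a x) (fun i => ?_), rfl⟩
  cases i with
  | none => exact hb.symm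
  | some i => exact hx i

theorem exists_isUnitBasis (p : ℕ) [Fact p.Prime] (A B : Subgroup Fˣ) (hB : unitPowers p F ≤ B) :
    ∃ (J : Type u) (x : J → Additive Fˣ), #J = dimQuot p A B hB ∧ IsUnitBasis p A B x := by
  let _ : Module (ZMod p) (UnitQuotient A B) :=
    AddCommGroup.zmodModule (UnitQuotient.nsmul_eq_zero p A B hB)
  let b := Module.Basis.ofVectorSpace (ZMod p) (UnitQuotient A B)
  obtain ⟨x, hx⟩ := exists_isUnitBasis_of_basis b
  exact ⟨_, x, b.mk_eq_rank'', hx⟩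

theorem exists_isUnitBasis_option (p : ℕ) [Fact p.Prime] (A B : Subgroup Fˣ)
    (hB : unitPowers p F ≤ B) (a : Fˣ) (ha : a ∈ A) (ha' : a ∉ B) :
    ∃ (J : Type u) (x : Option J → Additive Fˣ), #J + 1 = dimQuot p A B hB ∧
      IsUnitBasis p A B x ∧ x none = Additive.ofMul a := by
  let _ : Module (ZMod p) (UnitQuotient A B) :=
    AddCommGroup.zmodModule (UnitQuotient.nsmul_eq_zero p A B hB)
  obtain ⟨J, b, hb⟩ := exists_basis_option (k := ZMod p)
    (v := UnitQuotient.mk A B (Additive.ofMul ⟨a, ha⟩))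
    (fun h => ha' ((UnitQuotient.mk_eq_zero _).1 h))
  obtain ⟨x, hx, hx'⟩ := exists_isUnitBasis_of_basis_option b hb
  exact ⟨J, x, by rw [← Cardinal.mk_option]; exact b.mk_eq_rank'', hx, hx'⟩

end Bases

/-! ### Quadratic extensions -/

section QuadraticExtension

variable {F : Type u} {K : Type v} [Field F] [Field K] [Algebra F K]

/-- The norm on units. -/
noncomputable abbrev unitsNorm (F : Type u) (K : Type v) [Field F] [Field K] [Algebra F K] :
    Kˣ →* Fˣ := Units.map (Algebra.norm F : K →* F)

/-- The inclusion on units. -/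
abbrev unitsIncl (F : Type u) (K : Type v) [Field F] [Field K] [Algebra F K] :
    Fˣ →* Kˣ := Units.map (algebraMap F K : F →* K)

/-- A quadratic Galois extension of a field of characteristic not two, with generator `σ` of the
Galois group, such that `-1` is not a norm. -/
structure IsQuadraticPair (σ : Gal(K/F)) : Prop where
  two_ne_zero : (2 : K) ≠ 0
  ne_one : σ ≠ 1
  eq_or : ∀ τ : Gal(K/F), τ = 1 ∨ τ = σ
  sq : σ * σ = 1
  norm_ne : ∀ y : Kˣ, unitsNorm F K y ≠ -1

theorem IsQuadraticPair.of_finrank [IsGalois F K] (hdeg : Module.finrank F K = 2)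
    (hξ : ∃ ζ : F, IsPrimitiveRoot ζ 2)
    (hnorm : ¬ ∃ x : Kˣ, Algebra.norm F (x : K) = -1)
    (σ : Gal(K/F)) (hσ : ∀ τ : Gal(K/F), τ ∈ Subgroup.zpowers σ) : IsQuadraticPair σ := by
  have : FiniteDimensional F K := Module.finite_of_finrank_eq_succ hdeg
  have ho : orderOf σ = 2 := by
    rw [orderOf_eq_card_of_forall_mem_zpowers hσ, IsGalois.card_aut_eq_finrank, hdeg]
  have hsq : σ * σ = 1 := by rw [← pow_two, ← ho, pow_orderOf_eq_one]
  constructor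
  · obtain ⟨ζ, hζ⟩ := hξ
    intro h
    have h2 : (2 : F) = 0 := (algebraMap F K).injective (by rw [map_ofNat, map_zero]; exact h)
    -- In characteristic two, ζ² = 1 reads (ζ - 1)² = 0.
    have h1 : (ζ - 1) * (ζ - 1) = 0 := by
      have := hζ.pow_eq_one
      linear_combination this + (1 - ζ) * h2
    exact hζ.ne_one (by norm_num) (sub_eq_zero.1 (mul_self_eq_zero.1 h1))
  · intro h
    rw [h, orderOf_one] at ho
    omega
  · intro τ
    obtain ⟨k, rfl⟩ := hσ τ
    obtain ⟨l, hl | hl⟩ := k.even_or_odd' <;> subst hl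
    · left
      simp [zpow_mul, pow_two, hsq]
    · right
      simp [zpow_add, zpow_mul, pow_two, hsq]
  · exact hsq
  · exact fun y hy => hnorm ⟨y, by simpa using congrArg Units.val hy⟩

namespace IsQuadraticPair

variable {σ : Gal(K/F)}

theorem smul_smul (h : IsQuadraticPair σ) (y : Kˣ) : σ • σ • y = y := by
  rw [_root_.smul_smul, h.sq, one_smul]

theorem incl_norm [IsGalois F K] [FiniteDimensional F K] (h : IsQuadraticPair σ) (y : Kˣ) :
    unitsIncl F K (unitsNorm F K y) = y * σ • y := by
  classical
  ext
  have hu : (Finset.univ : Finset Gal(K/F)) = {1, σ} := by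
    ext τ
    simpa using h.eq_or τ
  have := Algebra.norm_eq_prod_automorphisms F (y : K)
  rw [hu, Finset.prod_pair h.ne_one.symm] at this
  exact this

theorem incl_injective : Function.Injective (unitsIncl F K) :=
  Units.map_injective (algebraMap F K).injective

theorem smul_incl (g : Gal(K/F)) (e : Fˣ) : g • unitsIncl F K e = unitsIncl F K e := by
  ext
  exact g.commutes e

theorem exists_incl [IsGalois F K] [FiniteDimensional F K] (h : IsQuadraticPair σ) {y : Kˣ}
    (hy : σ • y = y) : ∃ e, unitsIncl F K e = y := by
  obtain ⟨e, he⟩ := (IsGalois.mem_range_algebraMap_iff_fixed (F := F) (y : K)).2 (fun τ => by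
    rcases h.eq_or τ with rfl | rfl
    · rfl
    · exact congrArg Units.val hy)
  have he0 : e ≠ 0 := by
    rintro rfl
    exact y.ne_zero (by rw [← he, map_zero])
  exact ⟨Units.mk0 e he0, Units.ext he⟩

theorem norm_incl [IsGalois F K] [FiniteDimensional F K] (h : IsQuadraticPair σ) (e : Fˣ) :
    unitsNorm F K (unitsIncl F K e) = e ^ 2 := by
  apply incl_injective (K := K)
  rw [h.incl_norm, smul_incl, map_pow, pow_two]

theorem norm_smul [IsGalois F K] [FiniteDimensional F K] (h : IsQuadraticPair σ) (y : Kˣ) :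
    unitsNorm F K (σ • y) = unitsNorm F K y := by
  apply incl_injective (K := K)
  rw [h.incl_norm, h.incl_norm, h.smul_smul, mul_comm]

theorem exists_sqrt (h : IsQuadraticPair σ) : ∃ d : Kˣ, σ • d = -d := by
  obtain ⟨x, hx⟩ : ∃ x : K, σ x ≠ x := by
    by_contra! hc
    exact h.ne_one (AlgEquiv.ext hc)
  refine ⟨Units.mk0 (x - σ x) (sub_ne_zero.2 hx.symm), ?_⟩
  ext
  have : σ (σ x) = x := DFunLike.congr_fun h.sq x
  change σ (x - σ x) = -(x - σ x)
  rw [map_sub, this, neg_sub]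

/-- Hilbert 90 with the explicit witness w = 1 + σy, which vanishes only for y = -1. In that case
any d with σd = -d serves. -/
theorem exists_of_norm_eq_one [IsGalois F K] [FiniteDimensional F K] (h : IsQuadraticPair σ)
    {y : Kˣ} (hy : unitsNorm F K y = 1) : ∃ w : Kˣ, y = σ • w / w := by
  have hy1 : y * σ • y = 1 := by rw [← h.incl_norm, hy, map_one]
  by_cases hne : y = -1
  · obtain ⟨d, hd⟩ := h.exists_sqrt
    exact ⟨d, by rw [hd, hne, neg_div, div_self']⟩
  · have hy2 : (y : K) * σ y = 1 := congrArg Units.val hy1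
    have hσσ : σ (σ y) = y := congrArg Units.val (h.smul_smul y)
    have hw : 1 + σ (y : K) ≠ 0 := by
      intro h0
      refine hne (Units.ext ?_)
      rw [Units.val_neg, Units.val_one]
      linear_combination (y : K) * h0 - hy2
    refine ⟨Units.mk0 _ hw, ?_⟩
    rw [eq_div_iff_mul_eq']
    ext
    change (y : K) * (1 + σ y) = σ (1 + σ y)
    rw [map_add, map_one, hσσ]
    linear_combination hy2

/-- A square root y in K of an element of F satisfies σy = y or σy = -y, so y or y/d lies in F. -/
theorem incl_eq_sq [IsGalois F K] [FiniteDimensional F K] (h : IsQuadraticPair σ) {d : Kˣ}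
    (hd : σ • d = -d) {a : Fˣ} (ha : unitsIncl F K a = d ^ 2) {e : Fˣ} {y : Kˣ}
    (hy : unitsIncl F K e = y ^ 2) : ∃ e', e = e' ^ 2 ∨ e = a * e' ^ 2 := by
  have hsq : (σ • y) ^ 2 = y ^ 2 := by rw [← smul_pow', ← hy, smul_incl]
  have hsq' : ((σ • y : Kˣ) : K) ^ 2 = (y : K) ^ 2 := by exact_mod_cast congrArg Units.val hsq
  rcases sq_eq_sq_iff_eq_or_eq_neg.1 hsq' with h1 | h1
  · obtain ⟨e', he'⟩ := h.exists_incl (Units.ext h1)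
    exact ⟨e', Or.inl (incl_injective (K := K) (by rw [hy, map_pow, he']))⟩
  · have h1' : σ • y = -y := Units.ext (by simpa using h1)
    obtain ⟨e', he'⟩ := h.exists_incl (y := y / d) (by
      rw [smul_div', h1', hd, neg_div_neg_eq])
    refine ⟨e', Or.inr (incl_injective (K := K) ?_)⟩
    rw [hy, map_mul, map_pow, he', ha, div_pow, mul_div_cancel]

/-- The norm of d is -d² = -a, so a = N(y) would give N(d/y) = -1. -/
theorem norm_ne_of_sqrt [IsGalois F K] [FiniteDimensional F K] (h : IsQuadraticPair σ) {d : Kˣ}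
    (hd : σ • d = -d) {a : Fˣ} (ha : unitsIncl F K a = d ^ 2) (y : Kˣ) :
    a ≠ unitsNorm F K y := by
  rintro rfl
  refine h.norm_ne (d / y) (incl_injective (K := K) ?_)
  rw [map_div, map_div, ha, h.incl_norm, hd]
  ext
  simp [pow_two]

theorem normPowers_eq [IsGalois F K] [FiniteDimensional F K] (h : IsQuadraticPair σ) :
    normPowers F K 2 = (unitsNorm F K).range := by
  refine sup_eq_left.2 ?_
  rintro _ ⟨e, rfl⟩
  exact ⟨unitsIncl F K e, h.norm_incl e⟩

theorem normPowers_self (p : ℕ) : normPowers F F p = ⊤ := by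
  refine eq_top_iff.2 fun e _ => Subgroup.mem_sup_left ⟨e, ?_⟩
  ext
  simp

/-- The norm on units, written additively. -/
noncomputable abbrev addNorm (F : Type u) (K : Type v) [Field F] [Field K] [Algebra F K] :
    Additive Kˣ →+ Additive Fˣ := (unitsNorm F K).toAdditive

/-- The inclusion on units, written additively. -/
abbrev addIncl (F : Type u) (K : Type v) [Field F] [Field K] [Algebra F K] :
    Additive Fˣ →+ Additive Kˣ := (unitsIncl F K).toAdditive

open Finsupp in
-- The basis vector a of Fˣ modulo norms becomes a square in K and is dropped; this is the `+ 1`.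
-- The family `x` stays arbitrary so that α can be prescribed as a member when ν is finite.
theorem exists_trivial_part [IsGalois F K] [FiniteDimensional F K] (h : IsQuadraticPair σ) :
    ∃ (ι : Type u) (f : ι → Additive Kˣ), #ι + 1 = rankZero F K 2 ∧
      (∀ g i, unitsRep F K g (f i) = f i) ∧
      ∀ (J : Type u) (x : J → Additive Kˣ),
        IsUnitBasis 2 (normPowers F K 2) (unitPowers 2 F) (fun i => addNorm F K (x i)) →
        IsModPowIso 2 1 ((trivialSumMap f).coprod (freeSumMap (unitsRep F K) x)) := by
  obtain ⟨d, hd⟩ := h.exists_sqrt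
  obtain ⟨a, ha⟩ := h.exists_incl (y := d ^ 2) (by rw [smul_pow', hd, neg_sq])
  have haN : a ∉ normPowers F K 2 := by
    rw [h.normPowers_eq]
    rintro ⟨y, hy⟩
    exact h.norm_ne_of_sqrt hd ha y hy.symm
  obtain ⟨ι, f, hι, hf, hfa⟩ := exists_isUnitBasis_option 2 (normPowers F F 2) (normPowers F K 2)
    le_sup_right a (normPowers_self (F := F) 2 ▸ Subgroup.mem_top a) haN
  refine ⟨ι, fun i => addIncl F K (f (some i)), hι, fun g i => smul_incl g _, fun J x hx => ?_⟩
  have hsum (u : J →₀ ℤ) : linearCombination ℤ (fun i => addNorm F K (x i)) u =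
      addNorm F K (linearCombination ℤ x u) := by
    rw [linearCombination_apply, linearCombination_apply, map_finsuppSum]
    simp only [map_zsmul]
  refine isModPowIso_sum_of_involution h.ne_one h.eq_or ?_
  refine isModPowIso_two_one_of_norm (unitsRep F K σ).toAddMonoidHom (addIncl F K) (addNorm F K)
    (Additive.ofMul a) h.incl_norm h.norm_incl h.norm_smul (fun y hy => h.exists_of_norm_eq_one hy)
    ⟨Additive.ofMul d, ha⟩ (fun e y hy => h.incl_eq_sq hd ha hy) (h.norm_ne_of_sqrt hd ha)
    (fun i => f (some i)) x ?_ ?_ ?_ ?_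
  · intro e
    obtain ⟨u, hu⟩ := hf.span e (normPowers_self (F := F) 2 ▸ Subgroup.mem_top _)
    rw [h.normPowers_eq] at hu
    obtain ⟨y, hy⟩ := hu
    refine ⟨u.some, u none, Additive.ofMul y, ?_⟩
    have hy' : addNorm F K (Additive.ofMul y) = e - linearCombination ℤ f u := hy
    rw [hy', linearCombination_option, hfa]
    simp only [Function.comp_def]
    abel
  · intro c k y hy
    -- The slot `none` of the basis carries the coefficient of a.
    obtain ⟨u', hu'⟩ := hf.indep (optionEquiv.symm (k, c)) (by
      have e := optionEquiv.apply_symm_apply (k, c)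
      have e₁ : (optionEquiv.symm (k, c) : Option ι →₀ ℤ) none = k := congrArg Prod.fst e
      have e₂ : (optionEquiv.symm (k, c) : Option ι →₀ ℤ).some = c := congrArg Prod.snd e
      rw [linearCombination_option, hfa, e₁, e₂, add_comm, h.normPowers_eq]
      exact ⟨Additive.toMul y, hy.symm⟩)
    refine ⟨u'.some, ?_⟩
    have e := congrArg (fun z : Option ι →₀ ℤ => z.some) hu'
    ext i
    have e' := DFunLike.congr_fun e i
    have e'' := congrArg Prod.snd (optionEquiv.apply_symm_apply (k, c))
    exact (DFunLike.congr_fun e'' i).symm.trans e'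
  · intro y
    obtain ⟨u, e, he⟩ := hx.span (addNorm F K y) (by
      rw [h.normPowers_eq]
      exact ⟨Additive.toMul y, rfl⟩)
    refine ⟨u, Additive.ofMul e, ?_⟩
    have he' : 2 • Additive.ofMul e = addNorm F K y -
      linearCombination ℤ (fun i => addNorm F K (x i)) u := he
    rw [he', hsum]
    abel
  · intro u e he
    exact hx.indep u (by rw [hsum, he]; exact ⟨Additive.toMul e, rfl⟩)

theorem two_nsmul_eq_zero {w : Additive Kˣ} (hw : 2 • w = 0) :
    w = 0 ∨ w = Additive.ofMul (-1) := by
  have h1 : (Additive.toMul w : Kˣ) * Additive.toMul w = 1 := (pow_two _).symm.trans hw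
  exact (mul_self_eq_one_iff.1 (congrArg Units.val h1)).imp (fun e => Units.ext e)
    (fun e => Units.ext e)

end IsQuadraticPair

end QuadraticExtension

/-! ### Roots of unity -/

section Roots

variable {K : Type*} [Field K]

theorem le_rootLevel {p k : ℕ} {ζ : K} (hζ : IsPrimitiveRoot ζ (p ^ k)) :
    (k : ℕ∞) ≤ rootLevel p K := le_sSup ⟨k, rfl, ζ, hζ⟩

theorem exists_isPrimitiveRoot_of_rootLevel_eq_top {p : ℕ} (hp : p ≠ 0) (h : rootLevel p K = ⊤)
    (k : ℕ) : ∃ ζ : K, IsPrimitiveRoot ζ (p ^ k) := by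
  by_contra hc
  have : rootLevel p K ≤ k := by
    refine sSup_le ?_
    rintro _ ⟨l, rfl, ζ, hζ⟩
    by_contra hl
    have hkl : k ≤ l := by
      rw [Nat.cast_le, not_le] at hl
      exact hl.le
    refine hc ⟨ζ ^ p ^ (l - k), hζ.pow (pow_ne_zero _ hp).bot_lt ?_⟩
    rw [← pow_add, Nat.sub_add_cancel hkl]
  rw [h] at this
  exact absurd this (by simp)

theorem exists_isPrimitiveRoot_of_rootLevel_eq {p ν : ℕ} (h : rootLevel p K = ν) :
    ∃ ζ : K, IsPrimitiveRoot ζ (p ^ ν) := by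
  by_contra hc
  cases ν with
  | zero => exact hc ⟨1, by simp⟩
  | succ ν =>
    have : rootLevel p K ≤ ν := by
      refine sSup_le ?_
      rintro _ ⟨l, rfl, ζ, hζ⟩
      have hl := le_rootLevel hζ
      rw [h, Nat.cast_le] at hl
      rw [Nat.cast_le]
      have : l ≠ ν + 1 := by
        rintro rfl
        exact hc ⟨ζ, hζ⟩
      omega
    rw [h, Nat.cast_le] at this
    omega

theorem IsPrimitiveRoot.pow_two_pow_eq_neg_one {ζ : K} {k : ℕ} (h : IsPrimitiveRoot ζ (2 ^ (k + 1))) :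
    ζ ^ 2 ^ k = -1 :=
  (h.pow (pow_pos two_pos _) (pow_succ 2 k)).eq_neg_one_of_two_right

/-- The exponent must be positive: 1 is its own square root. -/
theorem IsPrimitiveRoot.of_sq {ζ y : K} {k : ℕ} (h : IsPrimitiveRoot ζ (2 ^ (k + 1)))
    (hy : ζ = y ^ 2) : IsPrimitiveRoot y (2 ^ (k + 2)) := by
  have h2 : (-1 : K) ≠ 1 := by
    rw [← h.pow_two_pow_eq_neg_one]
    exact h.pow_ne_one_of_pos_of_lt (pow_pos two_pos _).ne' (Nat.pow_lt_pow_succ one_lt_two)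
  rw [IsPrimitiveRoot.iff_orderOf]
  refine orderOf_eq_prime_pow (p := 2) (n := k + 1) ?_ ?_
  · rw [pow_succ', pow_mul, ← hy, h.pow_two_pow_eq_neg_one]
    exact h2
  · rw [pow_succ', pow_mul, ← hy, h.pow_eq_one]

end Roots

/-! ### Integral models of the power classes, and the role of roots of unity. -/

section Structure

variable {F : Type u} {K : Type v} [Field F] [Field K] [Algebra F K] {σ : Gal(K/F)}

/-- The only nontrivial 2-torsion element -1 is a 2^m-th power for every m, so the source needs no
torsion. -/
theorem isModPowIso_of_rootLevel_eq_top {V : Type*} [AddCommGroup V] (hν : rootLevel 2 K = ⊤)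
    {φ : V →+ Additive Kˣ} (hφ : IsModPowIso 2 1 φ) (m : ℕ) : IsModPowIso 2 m φ := by
  refine hφ.of_one (fun m w hw => ?_) m
  rcases IsQuadraticPair.two_nsmul_eq_zero hw with rfl | rfl
  · exact ⟨0, 0, by simp⟩
  · obtain ⟨ζ, hζ⟩ := exists_isPrimitiveRoot_of_rootLevel_eq_top two_ne_zero hν (m + 1)
    refine ⟨0, Additive.ofMul (Units.mk0 ζ (hζ.ne_zero (by positivity))), by simp, ?_⟩
    rw [map_zero, zero_add]
    exact Units.ext hζ.pow_two_pow_eq_neg_one.symm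

namespace IsQuadraticPair

/-- Inductively N(ξ)² = N(ξ²) = 1, and N(ξ) = -1 is excluded. -/
theorem norm_eq_one_of_isPrimitiveRoot (h : IsQuadraticPair σ) {k : ℕ} {ξ : Kˣ}
    (hξ : ξ ^ 2 ^ k = 1) : unitsNorm F K ξ = 1 := by
  induction k generalizing ξ with
  | zero => rw [pow_zero, pow_one] at hξ; rw [hξ, map_one]
  | succ k ih =>
    have h1 := ih (ξ := ξ ^ 2) (by rw [← pow_mul, ← pow_succ', hξ])
    rw [map_pow, pow_two] at h1
    have h2 := congrArg Units.val h1
    rw [Units.val_mul, Units.val_one, mul_self_eq_one_iff] at h2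
    exact Units.ext (h2.resolve_right fun e => h.norm_ne ξ (Units.ext e))

variable [IsGalois F K] [FiniteDimensional F K]

/-- Hilbert 90 is applied to a root of unity ξ of maximal 2-power order. The last claim lets the
norm of α belong to a basis of norms modulo squares. -/
theorem exists_cyclic_generator (h : IsQuadraticPair σ) {ν : ℕ} (hν : rootLevel 2 K = ν) :
    ∃ (ξ α : Kˣ) (k : ℕ), ν = k + 1 ∧ ξ ^ 2 ^ k = -1 ∧ σ • α / α = ξ ∧
      unitsNorm F K α ∉ unitPowers 2 F := by
  obtain ⟨ζ, hζ⟩ := exists_isPrimitiveRoot_of_rootLevel_eq hν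
  have h2 : (-1 : K) ≠ 1 := fun e => h.two_ne_zero (by linear_combination -e)
  have h1 : IsPrimitiveRoot (-1 : K) (2 ^ 1) := by
    rw [pow_one]
    exact IsPrimitiveRoot.mk_of_lt _ two_pos (by norm_num) fun l hl hl' => by
      obtain rfl : l = 1 := by omega
      simpa using h2
  have hν1 := le_rootLevel h1
  rw [hν, Nat.cast_le] at hν1
  obtain ⟨k, rfl⟩ : ∃ k, ν = k + 1 := ⟨ν - 1, by omega⟩
  let ξ : Kˣ := Units.mk0 ζ (hζ.ne_zero (by positivity))
  obtain ⟨α, hα⟩ := h.exists_of_norm_eq_one (h.norm_eq_one_of_isPrimitiveRoot (k := k + 1) (ξ := ξ)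
    (Units.ext hζ.pow_eq_one))
  refine ⟨ξ, α, k, rfl, Units.ext hζ.pow_two_pow_eq_neg_one, hα.symm, ?_⟩
  rintro ⟨e, he⟩
  -- If N(α) = e², then σα/α = ασα/α² = (e/α)², which yields a root of unity of order 2^(ν+1).
  have hξ : ξ = (unitsIncl F K e / α) ^ 2 := by
    have he' : unitsIncl F K e ^ 2 = α * σ • α := by
      rw [← h.incl_norm, ← he, ← map_pow]
      rfl
    rw [div_pow, he', hα, pow_two, mul_div_mul_left_eq_div]
  have := le_rootLevel (hζ.of_sq (congrArg Units.val hξ))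
  rw [hν, Nat.cast_le] at this
  omega

/-- The case of infinitely many roots of unity: a free abelian model of the power classes. -/
theorem exists_model_of_eq_top (h : IsQuadraticPair σ) (hν : rootLevel 2 K = ⊤) :
    ∃ (ι₀ ι₁ : Type u) (f : ι₀ → Additive Kˣ) (x : ι₁ → Additive Kˣ),
      #ι₀ + 1 = rankZero F K 2 ∧ #ι₁ = rankOne F K 2 ∧
      (∀ g i, unitsRep F K g (f i) = f i) ∧
      ∀ m, IsModPowIso 2 m ((trivialSumMap f).coprod (freeSumMap (unitsRep F K) x)) := by
  obtain ⟨ι₀, f, hι₀, hf, H⟩ := h.exists_trivial_part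
  obtain ⟨ι₁, z, hι₁, hz⟩ := exists_isUnitBasis 2 (normPowers F K 2) (unitPowers 2 F) le_rfl
  choose x hx using fun i => (h.normPowers_eq ▸ hz.mem i :
    Additive.toMul (z i) ∈ (unitsNorm F K).range)
  obtain rfl : (fun i => addNorm F K (Additive.ofMul (x i))) = z := funext hx
  exact ⟨ι₀, ι₁, f, _, hι₀, hι₁, hf, isModPowIso_of_rootLevel_eq_top hν (H ι₁ _ hz)⟩

/-- The case of finitely many roots of unity: a model of the power classes. -/
theorem exists_model_of_eq_natCast (h : IsQuadraticPair σ) {ν : ℕ} (hν : rootLevel 2 K = ν) :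
    ∃ (ι₀ ι₁ : Type u) (f : ι₀ → Additive Kˣ) (x : ι₁ → Additive Kˣ) (α : Additive Kˣ)
      (hα : 2 ^ ν • (unitsRep F K σ α - α) = 0),
      #ι₀ + 1 = rankZero F K 2 ∧ #ι₁ + 1 = rankOne F K 2 ∧
      (∀ g i, unitsRep F K g (f i) = f i) ∧
      ∀ m, IsModPowIso 2 m ((cyclicMap (unitsRep F K) 2 ν σ α hα).coprod
        ((trivialSumMap f).coprod (freeSumMap (unitsRep F K) x))) := by
  obtain ⟨ι₀, f, hι₀, hf, H⟩ := h.exists_trivial_part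
  obtain ⟨ξ, α, k, rfl, hξ, hα, hαN⟩ := h.exists_cyclic_generator hν
  obtain ⟨ι₁, z, hι₁, hz, hzα⟩ := exists_isUnitBasis_option 2 (normPowers F K 2) (unitPowers 2 F)
    le_rfl (unitsNorm F K α) (h.normPowers_eq ▸ ⟨α, rfl⟩) hαN
  choose y hy using fun i => (h.normPowers_eq ▸ hz.mem (some i) :
    Additive.toMul (z (some i)) ∈ (unitsNorm F K).range)
  -- The generator α occupies the slot `none`, whose free summand is then cut down to the cyclic
  -- module.
  let x : Option ι₁ → Additive Kˣ := fun i => i.elim (Additive.ofMul α) (fun i => Additive.ofMul (y i))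
  obtain rfl : (fun i => addNorm F K (x i)) = z := by
    funext i
    cases i with
    | none => exact hzα.symm
    | some i => exact hy i
  have hξ' : 2 ^ k • (unitsRep F K σ (Additive.ofMul α) - Additive.ofMul α) =
      Additive.ofMul (-1 : Kˣ) := by
    rw [← hξ, ← hα]
    rfl
  have hα' : 2 ^ (k + 1) • (unitsRep F K σ (Additive.ofMul α) - Additive.ofMul α) = 0 := by
    rw [pow_succ', mul_smul, hξ']
    exact neg_one_sq (R := Kˣ)
  have hI := isModPowIso_sum_option (ρ := unitsRep F K) (σ := σ) (f := f) (x := x) (ν := k + 1)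
    hα' (H (Option ι₁) x hz)
  refine ⟨ι₀, ι₁, f, x ∘ some, Additive.ofMul α, hα', hι₀, hι₁, hf, fun m => hI.of_one ?_ m⟩
  intro m w hw
  rcases two_nsmul_eq_zero hw with rfl | rfl
  · exact ⟨0, 0, by simp⟩
  -- Since ν = k + 1, the class of 2^k(σ-1) is 2-torsion in the cyclic module, and it maps to
  -- ξ^(2^k) = -1.
  · refine ⟨(Submodule.Quotient.mk (((2 : ℕ) : MonoidAlgebra ℤ Gal(K/F)) ^ k *
      (MonoidAlgebra.of ℤ Gal(K/F) σ - 1)), 0, 0), 0, Prod.ext ?_ (smul_zero 2), ?_⟩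
    · change (2 : ℕ) • Submodule.Quotient.mk _ = (0 : CyclicModule ℤ 2 (k + 1) σ)
      rw [← Submodule.Quotient.mk_smul, Submodule.Quotient.mk_eq_zero]
      refine Submodule.mem_span_singleton.2 ⟨1, ?_⟩
      rw [one_smul, pow_succ', mul_assoc, nsmul_eq_mul]
    · have e := (cyclicMap_relation (unitsRep F K) hα' k).trans hξ'
      rw [smul_zero, add_zero]
      exact (add_zero _).symm.trans (congrArg₂ (· + ·) e.symm
        (map_zero ((trivialSumMap f).coprod (freeSumMap (unitsRep F K) (x ∘ some)))).symm)

end IsQuadraticPair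

end Structure

/-! ### Assembling the decompositions -/

section Assembly

variable {G L : Type*} [Group G] [AddCommGroup L] {ρ : Representation ℤ G L}

theorem prodMap_equivariant {A B V V' W W' : Type*} [CommRing A] [CommRing B] [AddCommGroup V]
    [AddCommGroup V'] [AddCommGroup W] [AddCommGroup W'] [Module A V] [Module A V'] [Module B W]
    [Module B W'] {ρ₁ : Representation A G V} {ρ₁' : Representation A G V'}
    {ρ₂ : Representation B G W} {ρ₂' : Representation B G W'} {f : V →+ W} {f' : V' →+ W'}
    (hf : ∀ g x, f (ρ₁ g x) = ρ₂ g (f x)) (hf' : ∀ g x, f' (ρ₁' g x) = ρ₂' g (f' x)) (g : G)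
    (x : V × V') : f.prodMap f' (ρ₁.prod ρ₁' g x) = ρ₂.prod ρ₂' g (f.prodMap f' x) :=
  Prod.ext (hf g x.1) (hf' g x.2)

theorem coprod_equivariant {V V' : Type*} [AddCommGroup V] [AddCommGroup V']
    {ρ₁ : Representation ℤ G V} {ρ₁' : Representation ℤ G V'} {f : V →+ L} {f' : V' →+ L}
    (hf : ∀ g x, f (ρ₁ g x) = ρ g (f x)) (hf' : ∀ g x, f' (ρ₁' g x) = ρ g (f' x)) (g : G)
    (x : V × V') : f.coprod f' (ρ₁.prod ρ₁' g x) = ρ g (f.coprod f' x) := by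
  refine Eq.trans ?_ (map_add (ρ g) (f x.1) (f' x.2)).symm
  exact congrArg₂ (· + ·) (hf g x.1) (hf' g x.2)

variable (G) in
/-- The reduction of a trivial module is trivial and free. -/
noncomputable def trivialRepModPowEquiv (p m : ℕ) [Fact p.Prime] (ι : Type*) :
    ((trivialRep ℤ_[p] G ι).modPow p m).asModule ≃ₗ[MonoidAlgebra (ZMod (p ^ m)) G]
      (trivialRep (ZMod (p ^ m)) G ι).asModule :=
  (((isModPowIso_toZModPow p m).trivialRepMap ι).equiv
    (ρ' := trivialRep (ZMod (p ^ m)) G ι) (trivialRepMap_equivariant ι)).trans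
    (Representation.modPowSelf p m (trivialRep (ZMod (p ^ m)) G ι)).symm

variable (G) in
/-- The reduction of a free module is free. -/
noncomputable def freeRepModPowEquiv (p m : ℕ) [Fact p.Prime] (ι : Type*) :
    ((freeRep ℤ_[p] G ι).modPow p m).asModule ≃ₗ[MonoidAlgebra (ZMod (p ^ m)) G]
      (ι →₀ MonoidAlgebra (ZMod (p ^ m)) G) :=
  ((((isModPowIso_toZModPow p m).freeRepMap ι).equiv
    (ρ' := freeRep (ZMod (p ^ m)) G ι) (freeRepMap_equivariant ι)).trans
    (Representation.modPowSelf p m (freeRep (ZMod (p ^ m)) G ι)).symm).trans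
    (asModuleOfModule (ι →₀ MonoidAlgebra (ZMod (p ^ m)) G))

variable {p : ℕ} [Fact p.Prime] {ι₀ ι₁ : Type*}

variable (G p ι₀ ι₁) in
/-- The trivial and the free part of a model over `ℤ` and over `ℤ_p` agree modulo `p ^ m`. -/
theorem isModPowIso_trivial_free (m : ℕ) :
    IsModPowIso p m ((trivialRepMap (Int.castRingHom ℤ_[p]) ι₀).prodMap
      (freeRepMap G (Int.castRingHom ℤ_[p]) ι₁)) :=
  ((isModPowIso_intCast p m).trivialRepMap ι₀).prodMap ((isModPowIso_intCast p m).freeRepMap ι₁)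

variable (G p ι₀ ι₁) in
theorem trivial_free_equivariant (g : G) (x : (ι₀ →₀ ℤ) × (ι₁ →₀ MonoidAlgebra ℤ G)) :
    (trivialRepMap (Int.castRingHom ℤ_[p]) ι₀).prodMap (freeRepMap G (Int.castRingHom ℤ_[p]) ι₁)
      ((trivialRep ℤ G ι₀).prod (freeRep ℤ G ι₁) g x) =
    (trivialRep ℤ_[p] G ι₀).prod (freeRep ℤ_[p] G ι₁) g
      ((trivialRepMap (Int.castRingHom ℤ_[p]) ι₀).prodMap
        (freeRepMap G (Int.castRingHom ℤ_[p]) ι₁) x) :=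
  prodMap_equivariant (trivialRepMap_equivariant ι₀) (freeRepMap_equivariant ι₁) g x

variable (G p) in
/-- Finitely generated free modules are complete. -/
noncomputable def freeRepAdicEquiv [Finite G] (ι : Type*) [Finite ι] :
    ((freeRep ℤ_[p] G ι).adicCompletion p).asModule ≃ₗ[MonoidAlgebra ℤ_[p] G]
      (ι →₀ MonoidAlgebra ℤ_[p] G) :=
  (Representation.adicSelf p (freeRep ℤ_[p] G ι)).symm.trans
    (asModuleOfModule (ι →₀ MonoidAlgebra ℤ_[p] G))

/-- Cyclic modules are complete. -/
noncomputable def cyclicRepAdicEquiv [Finite G] (ν : ℕ) (σ : G) :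
    ((cyclicRep ℤ_[p] p ν σ).adicCompletion p).asModule ≃ₗ[MonoidAlgebra ℤ_[p] G]
      CyclicModule ℤ_[p] p ν σ :=
  (Representation.adicSelf p (cyclicRep ℤ_[p] p ν σ)).symm.trans
    (asModuleOfModule (CyclicModule ℤ_[p] p ν σ))

section TrivialFree

variable {f : ι₀ → L} {x : ι₁ → L} (hf : ∀ g i, ρ g (f i) = f i)
  (h : ∀ m, IsModPowIso p m ((trivialSumMap f).coprod (freeSumMap ρ x)))

/-- The decomposition of a reduction into a trivial and a free part. -/
noncomputable def modPowEquivTrivialFree (m : ℕ) :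
    (ρ.modPow p m).asModule ≃ₗ[MonoidAlgebra (ZMod (p ^ m)) G]
      ((trivialRep ℤ_[p] G ι₀).modPow p m).asModule ×
      ((freeRep ℤ_[p] G ι₁).modPow p m).asModule :=
  -- The integral model maps both to `L` and to the model over ℤ_p; one isomorphism is inverted and
  -- followed by the other.
  (((h m).equiv (coprod_equivariant (trivialSumMap_equivariant ρ hf)
    (freeSumMap_equivariant ρ x))).symm.trans
    ((isModPowIso_trivial_free G p ι₀ ι₁ m).equiv (trivial_free_equivariant G p ι₀ ι₁))).trans
    (Representation.modPowProd p m _ _)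

/-- The decomposition of a completion into a trivial and a free part. -/
noncomputable def adicEquivTrivialFree :
    (ρ.adicCompletion p).asModule ≃ₗ[MonoidAlgebra ℤ_[p] G]
      ((trivialRep ℤ_[p] G ι₀).adicCompletion p).asModule ×
      ((freeRep ℤ_[p] G ι₁).adicCompletion p).asModule :=
  ((Representation.adicEquiv p (coprod_equivariant (trivialSumMap_equivariant ρ hf)
    (freeSumMap_equivariant ρ x)) h).symm.trans
    (Representation.adicEquiv p (trivial_free_equivariant G p ι₀ ι₁)
      (isModPowIso_trivial_free G p ι₀ ι₁))).trans
    (Representation.adicProd p _ _)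

end TrivialFree

section CyclicTrivialFree

variable {f : ι₀ → L} {x : ι₁ → L} {ν : ℕ} {σ : G} {α : L}
  {hα : p ^ ν • (ρ σ α - α) = 0} (hf : ∀ g i, ρ g (f i) = f i)
  (h : ∀ m, IsModPowIso p m ((cyclicMap ρ p ν σ α hα).coprod
    ((trivialSumMap f).coprod (freeSumMap ρ x))))

/-- The decomposition of a reduction into a cyclic, a trivial and a free part. -/
noncomputable def modPowEquivCyclicTrivialFree (m : ℕ) :
    (ρ.modPow p m).asModule ≃ₗ[MonoidAlgebra (ZMod (p ^ m)) G]
      ((cyclicRep ℤ_[p] p ν σ).modPow p m).asModule ×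
      ((trivialRep ℤ_[p] G ι₀).modPow p m).asModule ×
      ((freeRep ℤ_[p] G ι₁).modPow p m).asModule :=
  ((((h m).equiv (coprod_equivariant (cyclicMap_equivariant ρ hα)
    (coprod_equivariant (trivialSumMap_equivariant ρ hf) (freeSumMap_equivariant ρ x)))).symm.trans
    ((((isModPowIso_intCast p m).cyclicRepMap ν σ).prodMap
      (isModPowIso_trivial_free G p ι₀ ι₁ m)).equiv (prodMap_equivariant
        (cyclicRepMap_equivariant ν σ) (trivial_free_equivariant G p ι₀ ι₁)))).trans
    (Representation.modPowProd p m _ _)).trans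
    ((LinearEquiv.refl _ _).prodCongr (Representation.modPowProd p m _ _))

/-- The decomposition of a completion into a cyclic, a trivial and a free part. -/
noncomputable def adicEquivCyclicTrivialFree [Finite G] :
    (ρ.adicCompletion p).asModule ≃ₗ[MonoidAlgebra ℤ_[p] G]
      CyclicModule ℤ_[p] p ν σ ×
      ((trivialRep ℤ_[p] G ι₀).adicCompletion p).asModule ×
      ((freeRep ℤ_[p] G ι₁).adicCompletion p).asModule :=
  (((Representation.adicEquiv p (coprod_equivariant (cyclicMap_equivariant ρ hα)
    (coprod_equivariant (trivialSumMap_equivariant ρ hf) (freeSumMap_equivariant ρ x))) h).symm.trans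
    (Representation.adicEquiv p (prodMap_equivariant
        (cyclicRepMap_equivariant ν σ) (trivial_free_equivariant G p ι₀ ι₁))
      (fun m => ((isModPowIso_intCast p m).cyclicRepMap ν σ).prodMap
        (isModPowIso_trivial_free G p ι₀ ι₁ m)))).trans
    (Representation.adicProd p _ _)).trans
    ((cyclicRepAdicEquiv ν σ).prodCongr (Representation.adicProd p _ _))

end CyclicTrivialFree

end Assembly

/-! ### The decomposition of the power classes. -/

theorem theorem2 {F : Type u} {K : Type v} [Field F] [Field K] [Algebra F K] [IsGalois F K]
    (hdeg : Module.finrank F K = 2)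
    (hξ : ∃ ζ : F, IsPrimitiveRoot ζ 2)
    (hnorm : ¬ ∃ x : Kˣ, Algebra.norm F (x : K) = -1)
    (σ : Gal(K/F)) (hσ : ∀ τ : Gal(K/F), τ ∈ Subgroup.zpowers σ) :
    -- the case `ν = ∞`
    (rootLevel 2 K = ⊤ →
      ∃ ι₀ ι₁ : Type u, #ι₀ + 1 = rankZero F K 2 ∧ #ι₁ = rankOne F K 2 ∧
        -- `J_∞` is the direct sum of the completions of the free modules `Y₀` and `Y₁`
        Nonempty (PowerClassesLimit F K 2 ≃ₗ[MonoidAlgebra ℤ_[2] Gal(K/F)]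
          ((trivialRep ℤ_[2] Gal(K/F) ι₀).adicCompletion 2).asModule ×
          ((freeRep ℤ_[2] Gal(K/F) ι₁).adicCompletion 2).asModule) ∧
        -- no completion is needed if the ranks are finite
        (Finite ι₀ → Finite ι₁ →
          Nonempty (PowerClassesLimit F K 2 ≃ₗ[MonoidAlgebra ℤ_[2] Gal(K/F)]
            (trivialRep ℤ_[2] Gal(K/F) ι₀).asModule × (ι₁ →₀ MonoidAlgebra ℤ_[2] Gal(K/F)))) ∧
        ∀ m : ℕ, 1 ≤ m →
          Nonempty (PowerClasses F K 2 m ≃ₗ[MonoidAlgebra (ZMod (2 ^ m)) Gal(K/F)]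
            ((trivialRep ℤ_[2] Gal(K/F) ι₀).modPow 2 m).asModule ×
            ((freeRep ℤ_[2] Gal(K/F) ι₁).modPow 2 m).asModule) ∧
          Nonempty (((trivialRep ℤ_[2] Gal(K/F) ι₀).modPow 2 m).asModule
            ≃ₗ[MonoidAlgebra (ZMod (2 ^ m)) Gal(K/F)]
              (trivialRep (ZMod (2 ^ m)) Gal(K/F) ι₀).asModule) ∧
          Nonempty (((freeRep ℤ_[2] Gal(K/F) ι₁).modPow 2 m).asModule
            ≃ₗ[MonoidAlgebra (ZMod (2 ^ m)) Gal(K/F)]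
              (ι₁ →₀ MonoidAlgebra (ZMod (2 ^ m)) Gal(K/F)))) ∧
    -- the case `ν < ∞`
    (∀ ν : ℕ, rootLevel 2 K = ν →
      IsIndecomposableModule (MonoidAlgebra ℤ_[2] Gal(K/F)) (CyclicModule ℤ_[2] 2 ν σ) ∧
      ∃ ι₀ ι₁ : Type u, #ι₀ + 1 = rankZero F K 2 ∧ #ι₁ + 1 = rankOne F K 2 ∧
        -- `J_∞` is the direct sum of `Z` and the completions of the free modules `Y₀` and `Y₁`
        Nonempty (PowerClassesLimit F K 2 ≃ₗ[MonoidAlgebra ℤ_[2] Gal(K/F)]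
          CyclicModule ℤ_[2] 2 ν σ ×
          ((trivialRep ℤ_[2] Gal(K/F) ι₀).adicCompletion 2).asModule ×
          ((freeRep ℤ_[2] Gal(K/F) ι₁).adicCompletion 2).asModule) ∧
        -- no completion is needed if the ranks are finite
        (Finite ι₀ → Finite ι₁ →
          Nonempty (PowerClassesLimit F K 2 ≃ₗ[MonoidAlgebra ℤ_[2] Gal(K/F)]
            CyclicModule ℤ_[2] 2 ν σ ×
            (trivialRep ℤ_[2] Gal(K/F) ι₀).asModule × (ι₁ →₀ MonoidAlgebra ℤ_[2] Gal(K/F)))) ∧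
        ∀ m : ℕ, 1 ≤ m →
          Nonempty (PowerClasses F K 2 m ≃ₗ[MonoidAlgebra (ZMod (2 ^ m)) Gal(K/F)]
            ((cyclicRep ℤ_[2] 2 ν σ).modPow 2 m).asModule ×
            ((trivialRep ℤ_[2] Gal(K/F) ι₀).modPow 2 m).asModule ×
            ((freeRep ℤ_[2] Gal(K/F) ι₁).modPow 2 m).asModule) ∧
          IsIndecomposableModule (MonoidAlgebra (ZMod (2 ^ m)) Gal(K/F))
            ((cyclicRep ℤ_[2] 2 ν σ).modPow 2 m).asModule ∧
          Nonempty (((trivialRep ℤ_[2] Gal(K/F) ι₀).modPow 2 m).asModule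
            ≃ₗ[MonoidAlgebra (ZMod (2 ^ m)) Gal(K/F)]
              (trivialRep (ZMod (2 ^ m)) Gal(K/F) ι₀).asModule) ∧
          Nonempty (((freeRep ℤ_[2] Gal(K/F) ι₁).modPow 2 m).asModule
            ≃ₗ[MonoidAlgebra (ZMod (2 ^ m)) Gal(K/F)]
              (ι₁ →₀ MonoidAlgebra (ZMod (2 ^ m)) Gal(K/F)))) := by
  have : FiniteDimensional F K := Module.finite_of_finrank_eq_succ hdeg
  have h := IsQuadraticPair.of_finrank hdeg hξ hnorm σ hσ
  refine ⟨fun hν => ?_, fun ν hν => ⟨?_, ?_⟩⟩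
  · obtain ⟨ι₀, ι₁, f, x, hι₀, hι₁, hf, H⟩ := h.exists_model_of_eq_top hν
    refine ⟨ι₀, ι₁, hι₀, hι₁, ⟨adicEquivTrivialFree hf H⟩, fun _ _ => ?_, fun m _ => ?_⟩
    · exact ⟨(adicEquivTrivialFree hf H).trans
        ((Representation.adicSelf 2 (trivialRep ℤ_[2] Gal(K/F) ι₀)).symm.prodCongr
          (freeRepAdicEquiv Gal(K/F) 2 ι₁))⟩
    · exact ⟨⟨modPowEquivTrivialFree hf H m⟩, ⟨trivialRepModPowEquiv Gal(K/F) 2 m ι₀⟩,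
        ⟨freeRepModPowEquiv Gal(K/F) 2 m ι₁⟩⟩
  · exact isIndecomposableModule_cyclicModule (PadicInt.prime_p (p := 2)).not_isUnit h.ne_one h.eq_or
      h.sq 2 ν
  · obtain ⟨ι₀, ι₁, f, x, α, hα, hι₀, hι₁, hf, H⟩ := h.exists_model_of_eq_natCast hν
    refine ⟨ι₀, ι₁, hι₀, hι₁, ⟨adicEquivCyclicTrivialFree hf H⟩, fun _ _ => ?_, fun m hm => ?_⟩
    · exact ⟨(adicEquivCyclicTrivialFree hf H).trans ((LinearEquiv.refl _ _).prodCongr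
        ((Representation.adicSelf 2 (trivialRep ℤ_[2] Gal(K/F) ι₀)).symm.prodCongr
          (freeRepAdicEquiv Gal(K/F) 2 ι₁)))⟩
    · exact ⟨⟨modPowEquivCyclicTrivialFree hf H m⟩,
        isIndecomposableModule_modPow_cyclicModule h.ne_one h.eq_or h.sq ν hm,
        ⟨trivialRepModPowEquiv Gal(K/F) 2 m ι₀⟩, ⟨freeRepModPowEquiv Gal(K/F) 2 m ι₁⟩⟩
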